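/- Let $|\cdot|$ be an arbitrary norm on $\mathbb R^d$ and let $X=(X_j)_{j\in\mathbb Z}$ be a strictly stationary $\mathbb R^d$-valued time series that is regularly varying with tail index $\alpha>0$, i.e. all its finite-dimensional vectors $(X_i,\dots,X_j)$ are multivariate regularly varying with index $\alpha$. Let $Y=(Y_j)_{j\in\mathbb Z}$ be its tail process: for all $i\le j$, the law of $x^{-1}(X_i,\dots,X_j)$ conditionally on $|X_0|>x$ converges weakly, as $x\to\infty$, to the law of $(Y_i,\dots,Y_j)$. Let $r_n\in\mathbb N$ and $u_n\in\mathbb R$ with $r_n\to\infty$ and $u_n\to\infty$. For $y\in(\mathbb R^d)^{\mathbb Z}$ put $y^*=\sup_{j\in\mathbb Z}|y_j|$ and $A_0(y)=\inf\{j\in\mathbb Z:\sup_{i\le j}|y_i|=y^*\}$ (with $\inf\emptyset=+\infty$). Assume: (DH) for all $x,y>0$, $$\lim_{k\to\infty}\limsup_{n\to\infty}\mathbb P\Big(\max_{k\le|j|\le r_n}|X_j|>u_nx\ \Big|\ |X_0|>u_ny\Big)=0;$$ (ANSJB) for all $\eta>0$, $$\lim_{\epsilon\downarrow0}\limsup_{n\to\infty}\frac{\mathbb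 P\big(\sum_{j=1}^{r_n}|X_j|\mathbf 1\{|X_j|\le\epsilon u_n\}>\eta u_n\big)}{r_n\,\mathbb P(|X_0|>u_n)}=0.$$ Then $\mathbb P(A_0(Y)\in\mathbb Z)=1$ and $\vartheta:=\mathbb P(A_0(Y)=0)>0$, so that one can let $Q=(Q_j)_{j\in\mathbb Z}$ be a random sequence whose law is that of $(Y^*)^{-1}Y$ conditionally on $A_0(Y)=0$; and $$\lim_{n\to\infty}\frac{\mathbb P\big(\sum_{j=1}^{r_n}|X_j|>u_n\big)}{r_n\,\mathbb P(|X_0|>u_n)}=\vartheta\,\mathbb E\Big[\Big(\sum_{j\in\mathbb Z}|Q_j|\Big)^\alpha\Big],\qquad \mathbb E\Big[\Big(\sum_{j\in\mathbb Z}|Q_j|\Big)^\alpha\Big]<\infty.$$ -/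

import Mathlib

open MeasureTheory ProbabilityTheory Filter Topology
open scoped ENNReal BoundedContinuousFunction

namespace ClusterIndex

noncomputable section

/-- A law `ν` on a normed space is (multivariate) regularly varying with tail index `α > 0`: the
rescaled tails `P(Z / x ∈ ·) / P(|Z| > x)` converge, on Borel sets bounded away from `0` whose
boundary is null for the limit, to a nonzero `(-α)`-homogeneous measure on the complement of `0`
that is finite on sets bounded away from `0`. -/
def RegularlyVaryingLaw {V : Type*} [NormedAddCommGroup V] [NormedSpace ℝ V] [MeasurableSpace V]
    (ν : Measure V) (α : ℝ) : Prop :=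
  0 < α ∧ ∃ μ : Measure V, μ ≠ 0 ∧ μ {0} = 0 ∧
    (∀ δ : ℝ, 0 < δ → μ {v | δ ≤ ‖v‖} < ∞) ∧
    (∀ t : ℝ, 0 < t → ∀ B : Set V, MeasurableSet B →
      μ {v | t⁻¹ • v ∈ B} = ENNReal.ofReal (t ^ (-α)) * μ B) ∧
    ∀ B : Set V, MeasurableSet B → (0 : V) ∉ closure B → μ (frontier B) = 0 →
      Tendsto (fun x : ℝ => ν {v | x⁻¹ • v ∈ B} / ν {v | x < ‖v‖}) atTop (𝓝 (μ B))

variable {E : Type*} [NormedAddCommGroup E] [NormedSpace ℝ E] [MeasurableSpace E]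
variable {Ω Ω' : Type*} [MeasurableSpace Ω] [MeasurableSpace Ω']

/-- The finite stretch `(X_i, …, X_j)` of a time series, as a random vector. -/
def stretch (X : ℤ → Ω → E) (i j : ℤ) (ω : Ω) : Finset.Icc i j → E :=
  fun k => X k ω

/-- (Strict) stationarity: shifting the time index does not change the law of the sequence. -/
def Stationary (P : Measure Ω) (X : ℤ → Ω → E) : Prop :=
  ∀ h : ℤ, P.map (fun ω (j : ℤ) => X (j + h) ω) = P.map (fun ω (j : ℤ) => X j ω)

/-- A time series is regularly varying with tail index `α` if all its finite stretches are. -/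
def RegularlyVaryingSeries (P : Measure Ω) (X : ℤ → Ω → E) (α : ℝ) : Prop :=
  ∀ i j : ℤ, i ≤ j → RegularlyVaryingLaw (P.map (stretch X i j)) α

/-- `Y` is the tail process of `X`: the law of `x⁻¹ (X_i, …, X_j)` conditionally on `|X_0| > x`
converges weakly, as `x → ∞`, to the law of `(Y_i, …, Y_j)`, for all `i ≤ j`. -/
def IsTailProcess (P : Measure Ω) (X : ℤ → Ω → E) (P' : Measure Ω') (Y : ℤ → Ω' → E) : Prop :=
  (∀ j, Measurable (Y j)) ∧
  ∀ i j : ℤ, i ≤ j → ∀ f : (Finset.Icc i j → E) →ᵇ ℝ,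
    Tendsto (fun x : ℝ => ∫ ω, f (x⁻¹ • stretch X i j ω) ∂(P[|{ω | x < ‖X 0 ω‖}])) atTop
      (𝓝 (∫ ω', f (stretch Y i j ω') ∂P'))

/-- `y^* = sup_j |y_j|`, with values in `[0, ∞]`. -/
def supNorm (y : ℤ → E) : ℝ≥0∞ := ⨆ i : ℤ, ‖y i‖ₑ

/-- The infargmax functional `inf {j : sup_{i ≤ j} |y_i| = y^*}`, with `inf ∅ = +∞`. -/
def infargmax (y : ℤ → E) : EReal :=
  ⨅ (j : ℤ) (_ : (⨆ (i : ℤ) (_ : i ≤ j), ‖y i‖ₑ) = supNorm y), ((j : ℝ) : EReal)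

/-- The event that the infargmax of `Y` is `0`. -/
def anchoredAtZero (Y : ℤ → Ω' → E) : Set Ω' :=
  {ω | infargmax (fun j => Y j ω) = 0}

/-- The candidate extremal index. -/
def candidateIndex (P' : Measure Ω') (Y : ℤ → Ω' → E) : ℝ≥0∞ :=
  P' (anchoredAtZero Y)

/-- The law of the sequence `Q`: the law of `(Y^*)⁻¹ Y` conditionally on the infargmax of `Y`
being `0` (on that event `Y^* = |Y_0|` is finite). -/
def lawQ (P' : Measure Ω') (Y : ℤ → Ω' → E) : Measure (ℤ → E) :=
  (P'[|anchoredAtZero Y]).map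
    (fun ω (j : ℤ) => (supNorm (fun i => Y i ω)).toReal⁻¹ • Y j ω)

/-- The anticlustering condition. -/
def CondDH (P : Measure Ω) (X : ℤ → Ω → E) (r : ℕ → ℕ) (u : ℕ → ℝ) : Prop :=
  ∀ x y : ℝ, 0 < x → 0 < y →
    Tendsto (fun k : ℕ =>
      limsup (fun n : ℕ =>
        P[{ω | ∃ j : ℤ, (k : ℤ) ≤ |j| ∧ |j| ≤ (r n : ℤ) ∧ u n * x < ‖X j ω‖} |
          {ω | u n * y < ‖X 0 ω‖}]) atTop)
      atTop (𝓝 0)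

/-- Asymptotic negligibility of small jumps. -/
def CondANSJB (P : Measure Ω) (X : ℤ → Ω → E) (r : ℕ → ℕ) (u : ℕ → ℝ) : Prop :=
  ∀ η : ℝ, 0 < η →
    Tendsto (fun ε : ℝ =>
      limsup (fun n : ℕ =>
        P {ω | η * u n < ∑ j ∈ Finset.Icc (1 : ℤ) (r n),
            {ω' | ‖X j ω'‖ ≤ ε * u n}.indicator (fun ω' => ‖X j ω'‖) ω} /
          ((r n : ℝ≥0∞) * P {ω | u n < ‖X 0 ω‖})) atTop)
      (𝓝[>] 0) (𝓝 0)

end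

end ClusterIndex

set_option linter.unusedSectionVars false

/-! Only the norms `ξ j = ‖X j‖` and `ζ j = ‖Y j‖` matter (`TailPair`, `tailPair_norm`). The tail
process inherits a time-change and scaling formula from stationarity and regular variation
(`timeChange`): `ζ 0` is Pareto and independent of scale-invariant functionals of `ζ`.
Anticlustering forces `ζ` to vanish at infinity (`ae_vanishes`), so a first maximum exists almost
surely; its being at `0` has positive probability because the time change carries the other
locations to `0`.

For the limit, keep only the terms above `ε u n`. A block with a large truncated sum is located by
its first exceedance; by anticlustering, the block looks like a single window around that time. This
gives the limit `ε^(-α)` times the probability that `ζ` has no exceedance of `1` before `0` and that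
its terms above `1` sum to more than `1/ε`. The sum event is shift invariant, so the anchor can be
moved from the first exceedance to the first maximum (`measure_anchor_eq`). With the first maximum
at `0`, integrating out the Pareto variable `ζ 0` compares the result with `clusterConst`, the
`α`-moment of the angular sum on that event.

The lower bound discards small terms and recovers `clusterConst` by Fatou
(`clusterConst_le_liminf`). The upper bound pays for the small terms with a share `η` of the
threshold, then sends `ε` and `η` to `0` (`limsup_measure_sum_le_div`). Finiteness comes from a
crude upper bound at one fixed `ε`, set against the lower bound. Finally
`candidateIndex_mul_lintegral` identifies `clusterConst` with `ϑ E[(∑ |Q_j|)^α]`. -/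

namespace ClusterIndex

/-! ### Time change and scaling for the tail process -/

/-- Finite measures that agree on bounded continuous functions vanishing off an open set `U`
agree on `U`. -/
lemma restrict_eq_of_forall_integral_eq {S : Type*} [TopologicalSpace S] [HasOuterApproxClosed S]
    [MeasurableSpace S] [BorelSpace S] {μ ν : Measure S} [IsFiniteMeasure μ] [IsFiniteMeasure ν]
    {U : Set S} (hU : IsOpen U)
    (h : ∀ f : S →ᵇ ℝ, (∀ x ∉ U, f x = 0) → ∫ x, f x ∂μ = ∫ x, f x ∂ν) :
    μ.restrict U = ν.restrict U := by
  have key : ∀ G : Set S, IsOpen G → G ⊆ U → μ G = ν G := by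
    intro G hG hGU
    have hF : IsClosed Gᶜ := hG.isClosed_compl
    -- These functions converge to the indicator of `G` and vanish off `G`, hence off `U`, so they
    -- are admissible test functions.
    let f : ℕ → S → ℝ := fun n x => 1 - (hF.apprSeq n x : ℝ)
    have hfc : ∀ n, Continuous (f n) := fun n =>
      continuous_const.sub (NNReal.continuous_coe.comp (hF.apprSeq n).continuous)
    have hf0 : ∀ n x, 0 ≤ f n x := fun n x =>
      sub_nonneg.2 (by exact_mod_cast HasOuterApproxClosed.apprSeq_apply_le_one hF n x)
    have hf1 : ∀ n x, f n x ≤ 1 := fun n x => sub_le_self _ (NNReal.coe_nonneg _)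
    have hfb : ∀ n x, ‖f n x‖ ≤ 1 := fun n x => by
      rw [Real.norm_of_nonneg (hf0 n x)]; exact hf1 n x
    have hflim : ∀ x, Tendsto (fun n => f n x) atTop (𝓝 (G.indicator (fun _ => (1 : ℝ)) x)) := by
      intro x
      have h1 := tendsto_pi_nhds.1 (HasOuterApproxClosed.tendsto_apprSeq hF) x
      have h2 := (NNReal.tendsto_coe.2 h1).const_sub (1 : ℝ)
      by_cases hx : x ∈ G <;> simpa [hx, f] using h2
    have hlim : ∀ (m : Measure S) [IsFiniteMeasure m],
        Tendsto (fun n => ∫ x, f n x ∂m) atTop (𝓝 (m.real G)) := by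
      intro m _
      have := tendsto_integral_of_dominated_convergence (μ := m) (F := f)
        (f := G.indicator (fun _ => (1 : ℝ))) (fun _ => 1)
        (fun n => (hfc n).measurable.aestronglyMeasurable) (integrable_const _)
        (fun n => ae_of_all _ (hfb n)) (ae_of_all _ hflim)
      simpa [integral_indicator hG.measurableSet] using this
    have heq : ∀ n, ∫ x, f n x ∂μ = ∫ x, f n x ∂ν := by
      intro n
      refine h (BoundedContinuousFunction.ofNormedAddCommGroup (f n) (hfc n) 1 (hfb n)) ?_
      intro x hx
      have : hF.apprSeq n x = 1 := HasOuterApproxClosed.apprSeq_apply_eq_one hF n (fun hxG => hx (hGU hxG))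
      simp [f, this]
    have := tendsto_nhds_unique (hlim μ) ((hlim ν).congr fun n => (heq n).symm)
    exact (measureReal_eq_measureReal_iff).1 this
  refine ext_of_generate_finite {s | IsOpen s} (BorelSpace.measurable_eq) (isPiSystem_isOpen) ?_ ?_
  · intro s hs
    rw [Measure.restrict_apply (IsOpen.measurableSet hs), Measure.restrict_apply (IsOpen.measurableSet hs)]
    exact key _ (IsOpen.inter hs hU) Set.inter_subset_right
  · simpa using key U hU subset_rfl

/-- A nonnegative stationary process `ξ` with regularly varying tails of index `α`, together with
its tail process `ζ`. -/
structure TailPair {Ω Ω' : Type*} [MeasurableSpace Ω] [MeasurableSpace Ω'] (P : Measure Ω)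
    (ξ : ℤ → Ω → ℝ) (P' : Measure Ω') (ζ : ℤ → Ω' → ℝ) (α : ℝ) : Prop where
  meas : ∀ j, Measurable (ξ j)
  meas' : ∀ j, Measurable (ζ j)
  nonneg' : ∀ j ω, 0 ≤ ζ j ω
  nonneg : ∀ j ω, 0 ≤ ξ j ω
  pos : 0 < α
  stat : ∀ h : ℤ, P.map (fun ω (j : ℤ) => ξ (j + h) ω) = P.map (fun ω (j : ℤ) => ξ j ω)
  ratio : ∀ s : ℝ, 0 < s → Tendsto (fun x : ℝ => P {ω | s * x < ξ 0 ω} / P {ω | x < ξ 0 ω}) atTop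
    (𝓝 (ENNReal.ofReal (s ^ (-α))))
  conv : ∀ (J : Finset ℤ) (a : ℤ) (f : (J → ℝ) →ᵇ ℝ),
    Tendsto (fun x : ℝ => ∫ ω, f (fun j => x⁻¹ * ξ (j - a) ω) ∂(P[|{ω | x < ξ 0 ω}])) atTop
      (𝓝 (∫ ω', f (fun j => ζ (j - a) ω') ∂P'))

variable {Ω Ω' : Type*} [MeasurableSpace Ω] [MeasurableSpace Ω'] {P : Measure Ω} {P' : Measure Ω'}
  [IsProbabilityMeasure P] [IsProbabilityMeasure P'] {ξ : ℤ → Ω → ℝ} {ζ : ℤ → Ω' → ℝ} {α : ℝ}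

namespace TailPair

lemma measurableSet_tail (h : TailPair P ξ P' ζ α) (j : ℤ) (x : ℝ) : MeasurableSet {ω | x < ξ j ω} :=
  measurableSet_lt measurable_const (h.meas j)

/-- Test the weak convergence on the constant `1`: conditioning on a null event yields the zero
measure, whose integral `0` is not close to `1`. -/
lemma tail_ne_zero (h : TailPair P ξ P' ζ α) : ∀ᶠ x : ℝ in atTop, P {ω | x < ξ 0 ω} ≠ 0 := by
  have h1 := h.conv ∅ 0 (BoundedContinuousFunction.const _ 1)
  simp only [BoundedContinuousFunction.const_apply, integral_const, smul_eq_mul, mul_one,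
    probReal_univ] at h1
  filter_upwards [h1.eventually (lt_mem_nhds (show (0 : ℝ) < 1 by norm_num))] with x hx h0
  rw [ProbabilityTheory.cond_eq_zero_of_meas_eq_zero h0] at hx
  simp at hx

/-- The stationarity of `ξ` at the level of integrals. -/
lemma integral_shift (h : TailPair P ξ P' ζ α) (a : ℤ) {g : (ℤ → ℝ) → ℝ} (hg : Measurable g) :
    ∫ ω, g (fun j => ξ j ω) ∂P = ∫ ω, g (fun j => ξ (j - a) ω) ∂P := by
  have h1 : Measurable (fun ω (j : ℤ) => ξ j ω) := measurable_pi_lambda _ fun j => h.meas j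
  have h2 : Measurable (fun ω (j : ℤ) => ξ (j + -a) ω) := measurable_pi_lambda _ fun j => h.meas _
  have h3 := h.stat (-a)
  simp only [sub_eq_add_neg]
  rw [← integral_map (φ := fun ω (j : ℤ) => ξ j ω) h1.aemeasurable hg.aestronglyMeasurable,
    ← integral_map (φ := fun ω (j : ℤ) => ξ (j + -a) ω) h2.aemeasurable hg.aestronglyMeasurable, h3]

lemma measure_shift (h : TailPair P ξ P' ζ α) (a : ℤ) {A : Set (ℤ → ℝ)} (hA : MeasurableSet A) :
    P {ω | (fun j => ξ j ω) ∈ A} = P {ω | (fun j => ξ (j + a) ω) ∈ A} := by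
  have h1 : Measurable (fun ω (j : ℤ) => ξ j ω) := measurable_pi_lambda _ fun j => h.meas j
  have h2 : Measurable (fun ω (j : ℤ) => ξ (j + a) ω) := measurable_pi_lambda _ fun j => h.meas _
  have h3 := congrArg (fun m => m A) (h.stat a)
  rw [Measure.map_apply h1 hA, Measure.map_apply h2 hA] at h3
  exact h3.symm

/-- Integrals of functions that vanish unless `ξ₀ > x`, in terms of conditional laws. -/
lemma integral_eq_mul_cond {ξ₀ : Ω → ℝ} (x : ℝ) {g : Ω → ℝ}
    (hg : ∀ ω, ¬ x < ξ₀ ω → g ω = 0) :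
    ∫ ω, g ω ∂P = P.real {ω | x < ξ₀ ω} * ∫ ω, g ω ∂(P[|{ω | x < ξ₀ ω}]) := by
  have h0 : ∫ ω, g ω ∂P = ∫ ω in {ω | x < ξ₀ ω}, g ω ∂P := by
    rw [setIntegral_eq_integral_of_forall_compl_eq_zero]
    intro ω hω
    exact hg ω hω
  rw [ProbabilityTheory.cond, integral_smul_measure, ← h0, ENNReal.toReal_inv, smul_eq_mul,
    ← measureReal_def, ← mul_assoc]
  by_cases hp : P.real {ω | x < ξ₀ ω} = 0
  · rw [hp]
    have : P {ω | x < ξ₀ ω} = 0 := (measureReal_eq_zero_iff).1 hp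
    rw [h0, Measure.restrict_eq_zero.2 this]; simp
  · rw [mul_inv_cancel₀ hp, one_mul]

/-- Vague convergence at an arbitrary time `a` and level `s`. -/
lemma tendsto_integral_div (h : TailPair P ξ P' ζ α) (J : Finset ℤ) (a : ℤ) (ha : a ∈ J) {s : ℝ}
    (hs : 0 < s) (f : (J → ℝ) →ᵇ ℝ) (hf : ∀ v, ¬ s < v ⟨a, ha⟩ → f v = 0) :
    Tendsto (fun x : ℝ => (∫ ω, f (fun j => x⁻¹ * ξ j ω) ∂P) / P.real {ω | x < ξ 0 ω}) atTop
      (𝓝 (s ^ (-α) * ∫ ω', f (fun j => s * ζ (j - a) ω') ∂P')) := by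
  have hcont : Continuous (fun v : J → ℝ => fun j => s * v j) := by fun_prop
  -- The weak convergence is used along the level `s * x`, with `f` rescaled by `s`; the tail ratio
  -- then accounts for normalising at level `x`.
  have h1 := (h.conv J a (f.compContinuous ⟨_, hcont⟩)).comp (tendsto_id.const_mul_atTop hs)
  have h2 := (ENNReal.tendsto_toReal ENNReal.ofReal_ne_top).comp (h.ratio s hs)
  have h3 := h2.mul h1
  rw [ENNReal.toReal_ofReal (Real.rpow_nonneg hs.le _)] at h3
  refine h3.congr' ?_
  filter_upwards [eventually_gt_atTop 0] with x hx
  simp only [Function.comp, BoundedContinuousFunction.compContinuous_apply, ContinuousMap.coe_mk,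
    id]
  have hgm : Measurable (fun y : ℤ → ℝ => f (fun j : J => x⁻¹ * y j)) :=
    f.continuous.measurable.comp (by fun_prop)
  have hscale : ∀ ω, (fun j : J => s * ((s * x)⁻¹ * ξ (j - a) ω)) = fun j : J => x⁻¹ * ξ (j - a) ω := by
    intro ω; ext j; field_simp
  simp only [hscale]
  -- Stationarity moves time `a` to time `0`, where the vanishing of `f` becomes an exceedance of `s
  -- * x` by `ξ 0`.
  rw [h.integral_shift a hgm, integral_eq_mul_cond (P := P) (ξ₀ := ξ 0) (s * x), ENNReal.toReal_div]
  · simp only [← measureReal_def]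
    ring
  · intro ω hω
    apply hf
    simp only [sub_self]
    contrapose! hω
    rwa [inv_mul_eq_div, lt_div_iff₀ hx] at hω

end TailPair

/-- `G` depends only on the coordinates in `J`. -/
def DependsOnCoords (G : Set (ℤ → ℝ)) (J : Finset ℤ) : Prop :=
  ∀ y y' : ℤ → ℝ, (∀ j ∈ J, y j = y' j) → y ∈ G → y' ∈ G

namespace TailPair

lemma measurable_path' (h : TailPair P ξ P' ζ α) : Measurable (fun ω (j : ℤ) => ζ j ω) :=
  measurable_pi_lambda _ fun j => h.meas' j

/-- The time-change and scaling formula for the tail process. -/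
theorem timeChange (h : TailPair P ξ P' ζ α) (a : ℤ) {s : ℝ} (hs : 0 < s) {A : Set (ℤ → ℝ)}
    (hA : MeasurableSet A) :
    P' {ω | (fun j => ζ j ω) ∈ A ∧ 1 < ζ 0 ω ∧ s < ζ a ω} =
      ENNReal.ofReal (s ^ (-α)) *
        P' {ω | (fun j => s * ζ (j - a) ω) ∈ A ∧ 1 < s * ζ (-a) ω ∧ 1 < ζ 0 ω} := by
  have hm1 : Measurable (fun ω (j : ℤ) => ζ j ω) := h.measurable_path'
  have hm2 : Measurable (fun ω (j : ℤ) => s * ζ (j - a) ω) :=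
    measurable_pi_lambda _ fun j => (h.meas' _).const_mul s
  set μ : Measure (ℤ → ℝ) := P'.map (fun ω (j : ℤ) => ζ j ω) with hμ
  set ν : Measure (ℤ → ℝ) :=
    ENNReal.ofReal (s ^ (-α)) • P'.map (fun ω (j : ℤ) => s * ζ (j - a) ω) with hν
  have : IsFiniteMeasure ν := Measure.smul_finite _ ENNReal.ofReal_ne_top
  let U : Set (ℤ → ℝ) := {y | 1 < y 0 ∧ s < y a}
  have hU : MeasurableSet U := (measurableSet_lt measurable_const (measurable_pi_apply 0)).inter
    (measurableSet_lt measurable_const (measurable_pi_apply a))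
  have big : ∀ J : Finset ℤ, 0 ∈ J → a ∈ J →
      (μ.restrict U).map J.restrict = (ν.restrict U).map J.restrict := by
    intro J h0 ha
    let V : Set (J → ℝ) := {v | 1 < v ⟨0, h0⟩ ∧ s < v ⟨a, ha⟩}
    have hV : IsOpen V := (isOpen_lt continuous_const (continuous_apply _)).inter
      (isOpen_lt continuous_const (continuous_apply _))
    have hUV : U = J.restrict ⁻¹' V := rfl
    have hr : Measurable (J.restrict : (ℤ → ℝ) → (J → ℝ)) := Finset.measurable_restrict J
    have : IsFiniteMeasure (ν.map J.restrict) := by infer_instance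
    rw [hUV, ← Measure.restrict_map hr hV.measurableSet, ← Measure.restrict_map hr hV.measurableSet]
    refine restrict_eq_of_forall_integral_eq hV fun f hf => ?_
    -- The same normalised integral has two expressions for its limit: one conditions at time `0`
    -- and level `1`, the other at time `a` and level `s`.
    have t1 := h.tendsto_integral_div J 0 h0 one_pos f
      (fun v hv => hf v fun hvV => hv hvV.1)
    have t2 := h.tendsto_integral_div J a ha hs f (fun v hv => hf v fun hvV => hv hvV.2)
    have t3 := tendsto_nhds_unique t1 t2
    rw [integral_map hr.aemeasurable f.continuous.measurable.aestronglyMeasurable,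
      integral_map hr.aemeasurable f.continuous.measurable.aestronglyMeasurable, hμ, hν,
      integral_smul_measure,
      integral_map (f := fun y => f (J.restrict y)) hm1.aemeasurable
        (f.continuous.measurable.comp hr).aestronglyMeasurable,
      integral_map (f := fun y => f (J.restrict y)) hm2.aemeasurable
        (f.continuous.measurable.comp hr).aestronglyMeasurable,
      ENNReal.toReal_ofReal (Real.rpow_nonneg hs.le _)]
    simp only [Real.one_rpow, one_mul, sub_zero] at t3
    exact t3
  -- Only windows containing `0` and `a` have been compared; any other window is first enlarged by
  -- these two times and then projected back.
  have all : μ.restrict U = ν.restrict U := by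
    refine IsProjectiveLimit.unique (P := fun I : Finset ℤ => (μ.restrict U).map I.restrict)
      (fun I => rfl) (fun I => ?_)
    have hsub : I ⊆ I ∪ {0, a} := Finset.subset_union_left
    have e1 : (I.restrict : (ℤ → ℝ) → (I → ℝ)) =
        Finset.restrict₂ (π := fun _ => ℝ) hsub ∘ (I ∪ {0, a}).restrict := rfl
    have m1 : Measurable (Finset.restrict₂ (π := fun _ : ℤ => ℝ) hsub) :=
      Finset.measurable_restrict₂ hsub
    simp only
    rw [e1, ← Measure.map_map m1 (Finset.measurable_restrict _), ← big _ (by simp) (by simp),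
      Measure.map_map m1 (Finset.measurable_restrict _)]
  have fin := congrArg (fun m => m A) all
  simp only [Measure.restrict_apply hA] at fin
  rw [hμ, hν, Measure.smul_apply, Measure.map_apply hm1 (hA.inter hU),
    Measure.map_apply hm2 (hA.inter hU), smul_eq_mul] at fin
  refine fin.trans ?_
  congr 2
  ext ω
  change _ ∧ 1 < s * ζ (0 - a) ω ∧ s < s * ζ (a - a) ω ↔ _ ∧ 1 < s * ζ (-a) ω ∧ 1 < ζ 0 ω
  rw [sub_self, zero_sub, lt_mul_iff_one_lt_right hs]

/-! ### Portmanteau bounds for events in finitely many coordinates -/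

theorem measure_open_le_liminf (h : TailPair P ξ P' ζ α) {G : Set (ℤ → ℝ)} (hG : IsOpen G)
    {J : Finset ℤ} (hJ : DependsOnCoords G J) :
    P' {ω | (fun j => ζ j ω) ∈ G} ≤
      liminf (fun x : ℝ => P[{ω | (fun j => x⁻¹ * ξ j ω) ∈ G} | {ω | x < ξ 0 ω}]) atTop := by
  classical
  -- Extension by zero: since `G` only sees the coordinates in `J`, it can be tested in finite
  -- dimension.
  let e : (J → ℝ) → (ℤ → ℝ) := fun v j => if hj : j ∈ J then v ⟨j, hj⟩ else 0
  have he : Continuous e := by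
    refine continuous_pi fun j => ?_
    by_cases hj : j ∈ J
    · simpa [e, hj] using continuous_apply _
    · simpa [e, hj] using continuous_const
  have hGJ : IsOpen (e ⁻¹' G) := hG.preimage he
  have heG : ∀ y : ℤ → ℝ, (fun j : J => y j) ∈ e ⁻¹' G ↔ y ∈ G := fun y =>
    ⟨fun hy => hJ _ _ (fun j hj => by simp [e, hj]) hy,
      fun hy => hJ _ _ (fun j hj => by simp [e, hj]) hy⟩
  have hm : ∀ x : ℝ, Measurable (fun ω (j : J) => x⁻¹ * ξ j ω) := fun x =>
    measurable_pi_lambda _ fun j => (h.meas _).const_mul _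
  have hm' : Measurable (fun ω (j : J) => ζ j ω) := measurable_pi_lambda _ fun j => h.meas' _
  let μ : ProbabilityMeasure (J → ℝ) := ⟨P'.map (fun ω (j : J) => ζ j ω),
    Measure.isProbabilityMeasure_map hm'.aemeasurable⟩
  -- The Dirac mass is a default value for null conditioning events, which do not occur for large
  -- `x`.
  let μs : ℝ → ProbabilityMeasure (J → ℝ) := fun x =>
    if hx : P {ω | x < ξ 0 ω} ≠ 0 then
      ⟨(P[|{ω | x < ξ 0 ω}]).map (fun ω (j : J) => x⁻¹ * ξ j ω),
        have := cond_isProbabilityMeasure hx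
        Measure.isProbabilityMeasure_map (hm x).aemeasurable⟩
    else ⟨Measure.dirac 0, inferInstance⟩
  have hμs : ∀ᶠ x : ℝ in atTop, (μs x : Measure (J → ℝ)) =
      (P[|{ω | x < ξ 0 ω}]).map (fun ω (j : J) => x⁻¹ * ξ j ω) := by
    filter_upwards [h.tail_ne_zero] with x hx
    simp [μs, hx]
  have ht : Tendsto μs atTop (𝓝 μ) := by
    rw [ProbabilityMeasure.tendsto_iff_forall_integral_tendsto]
    intro f
    have t := h.conv J 0 f
    simp only [sub_zero] at t
    rw [show (μ : Measure (J → ℝ)) = P'.map (fun ω (j : J) => ζ j ω) from rfl,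
      integral_map hm'.aemeasurable f.continuous.measurable.aestronglyMeasurable]
    refine t.congr' ?_
    filter_upwards [hμs] with x hx
    rw [hx, integral_map (hm x).aemeasurable f.continuous.measurable.aestronglyMeasurable]
  have key := ProbabilityMeasure.le_liminf_measure_open_of_tendsto ht hGJ
  rw [show (μ : Measure (J → ℝ)) = P'.map (fun ω (j : J) => ζ j ω) from rfl,
    Measure.map_apply hm' hGJ.measurableSet] at key
  calc P' {ω | (fun j => ζ j ω) ∈ G}
      = P' ((fun ω (j : J) => ζ j ω) ⁻¹' (e ⁻¹' G)) := by
        congr 1; ext ω; exact (heG _).symm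
    _ ≤ _ := key
    _ = _ := by
        refine liminf_congr ?_
        filter_upwards [hμs] with x hx
        rw [hx, Measure.map_apply (hm x) hGJ.measurableSet]
        congr 1; ext ω; exact heG (fun j => x⁻¹ * ξ j ω)

theorem limsup_measure_closed_le (h : TailPair P ξ P' ζ α) {F : Set (ℤ → ℝ)} (hF : IsClosed F)
    {J : Finset ℤ} (hJ : DependsOnCoords F J) :
    limsup (fun x : ℝ => P[{ω | (fun j => x⁻¹ * ξ j ω) ∈ F} | {ω | x < ξ 0 ω}]) atTop ≤
      P' {ω | (fun j => ζ j ω) ∈ F} := by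
  have hJc : DependsOnCoords Fᶜ J := fun y y' hy hyF hF' =>
    hyF (hJ y' y (fun j hj => (hy j hj).symm) hF')
  have key := h.measure_open_le_liminf hF.isOpen_compl hJc
  have hmF : MeasurableSet {ω | (fun j => ζ j ω) ∈ F} := h.measurable_path' hF.measurableSet
  have e1 : P' {ω | (fun j => ζ j ω) ∈ Fᶜ} = 1 - P' {ω | (fun j => ζ j ω) ∈ F} :=
    prob_compl_eq_one_sub hmF
  have e2 : ∀ᶠ x : ℝ in atTop, P[{ω | (fun j => x⁻¹ * ξ j ω) ∈ F} | {ω | x < ξ 0 ω}] =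
      1 - P[{ω | (fun j => x⁻¹ * ξ j ω) ∈ Fᶜ} | {ω | x < ξ 0 ω}] := by
    filter_upwards [h.tail_ne_zero] with x hx
    have := cond_isProbabilityMeasure hx
    have hm : Measurable (fun ω (j : ℤ) => x⁻¹ * ξ j ω) :=
      measurable_pi_lambda _ fun j => (h.meas _).const_mul _
    have := prob_compl_eq_one_sub (μ := P[|{ω | x < ξ 0 ω}]) (hm hF.isOpen_compl.measurableSet)
    rw [← Set.preimage_compl, compl_compl] at this
    exact this
  rw [limsup_congr e2, ENNReal.limsup_const_sub _ _ ENNReal.one_ne_top]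
  refine (tsub_le_tsub_left key 1).trans ?_
  rw [e1, ENNReal.sub_sub_cancel ENNReal.one_ne_top prob_le_one]

/-- A weak limit of laws on `(1, ∞)` could charge `1`. Regular variation excludes this: for `s > 1`
the closed-set bound gives `s ^ (-α) ≤ P'(s ≤ ζ 0)`, and `s ↓ 1`. -/
lemma one_lt_ae (h : TailPair P ξ P' ζ α) : ∀ᵐ ω ∂P', 1 < ζ 0 ω := by
  have hbd : ∀ s : ℝ, 1 < s → ENNReal.ofReal (s ^ (-α)) ≤ P' {ω | 1 < ζ 0 ω} := by
    intro s hs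
    have hF : IsClosed {y : ℤ → ℝ | s ≤ y 0} := isClosed_le continuous_const (continuous_apply _)
    have h1 := h.limsup_measure_closed_le hF (J := {0}) (fun y y' hy hs => by
      have := hy 0 (by simp)
      simp only [Set.mem_ofPred_eq] at hs ⊢
      rwa [← this])
    calc ENNReal.ofReal (s ^ (-α)) = limsup (fun x : ℝ => P {ω | s * x < ξ 0 ω} / P {ω | x < ξ 0 ω}) atTop :=
          (h.ratio s (by linarith)).limsup_eq.symm
      _ ≤ limsup (fun x : ℝ =>
          P[{ω | (fun j => x⁻¹ * ξ j ω) ∈ {y : ℤ → ℝ | s ≤ y 0}} | {ω | x < ξ 0 ω}]) atTop := by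
          refine limsup_le_limsup ?_
          filter_upwards [eventually_gt_atTop 0] with x hx
          rw [cond_apply (h.measurableSet_tail 0 x), ENNReal.div_eq_inv_mul]
          gcongr
          intro ω hω
          simp only [Set.mem_ofPred_eq, Set.mem_inter_iff] at hω ⊢
          refine ⟨by nlinarith, ?_⟩
          rw [inv_mul_eq_div, le_div_iff₀ hx]
          exact hω.le
      _ ≤ _ := h1
      _ ≤ _ := measure_mono fun ω hω => lt_of_lt_of_le hs hω
  have hlim : Tendsto (fun s : ℝ => ENNReal.ofReal (s ^ (-α))) (𝓝[>] 1) (𝓝 1) := by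
    have : Tendsto (fun s : ℝ => s ^ (-α)) (𝓝[>] 1) (𝓝 (1 ^ (-α))) :=
      ((Real.continuousAt_rpow_const 1 (-α) (Or.inl one_ne_zero)).tendsto).mono_left
        nhdsWithin_le_nhds
    have := ENNReal.tendsto_ofReal this
    simpa using this
  have h1 : 1 ≤ P' {ω | 1 < ζ 0 ω} :=
    le_of_tendsto hlim (eventually_nhdsWithin_of_forall fun s hs => hbd s hs)
  have h2 := (prob_compl_eq_zero_iff (measurableSet_lt measurable_const (h.meas' 0))).2
    (le_antisymm prob_le_one h1)
  exact h2

/-- Scaling formula for the tail process. -/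
lemma scaling (h : TailPair P ξ P' ζ α) {s : ℝ} (hs : 1 ≤ s) {A : Set (ℤ → ℝ)}
    (hA : MeasurableSet A) :
    P' {ω | (fun j => ζ j ω) ∈ A ∧ s < ζ 0 ω} =
      ENNReal.ofReal (s ^ (-α)) * P' {ω | (fun j => s * ζ j ω) ∈ A} := by
  have h1 := h.timeChange 0 (by linarith : 0 < s) hA
  simp only [sub_zero, neg_zero] at h1
  rw [show P' {ω | (fun j => ζ j ω) ∈ A ∧ s < ζ 0 ω} =
      P' {ω | (fun j => ζ j ω) ∈ A ∧ 1 < ζ 0 ω ∧ s < ζ 0 ω} from ?_, h1]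
  · congr 1
    refine measure_congr ?_
    filter_upwards [h.one_lt_ae] with ω hω
    have h2 : 1 < s * ζ 0 ω := by nlinarith
    exact propext ⟨fun hx => hx.1, fun hx => ⟨hx, h2, hω⟩⟩
  · congr 1; ext ω
    simp only [Set.mem_ofPred_eq]
    exact ⟨fun hx => ⟨hx.1, by linarith [hx.2], hx.2⟩, fun hx => ⟨hx.1, hx.2.2⟩⟩

/-- Time-change formula for the tail process. -/
lemma shift (h : TailPair P ξ P' ζ α) (a : ℤ) {A : Set (ℤ → ℝ)} (hA : MeasurableSet A) :
    P' {ω | (fun j => ζ j ω) ∈ A ∧ 1 < ζ a ω} =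
      P' {ω | (fun j => ζ (j - a) ω) ∈ A ∧ 1 < ζ (-a) ω} := by
  have h1 := h.timeChange a one_pos hA
  simp only [one_mul, Real.one_rpow, ENNReal.ofReal_one] at h1
  have e : ∀ (B : Ω' → Prop) (c : ℤ), P' {ω | B ω ∧ 1 < ζ c ω} = P' {ω | B ω ∧ 1 < ζ c ω ∧ 1 < ζ 0 ω} := by
    intro B c
    refine measure_congr ?_
    filter_upwards [h.one_lt_ae] with ω hω
    exact propext ⟨fun hx => ⟨hx.1, hx.2, hω⟩, fun hx => ⟨hx.1, hx.2.1⟩⟩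
  rw [e, e, ← h1]
  congr 1; ext ω; simp only [Set.mem_ofPred_eq]; tauto

end TailPair

/-! ### Vanishing of the tail process and change of anchor -/

/-- The anticlustering condition for a real process. -/
def AntiCluster (P : Measure Ω) (ξ : ℤ → Ω → ℝ) (r : ℕ → ℕ) (u : ℕ → ℝ) : Prop :=
  ∀ x y : ℝ, 0 < x → 0 < y →
    Tendsto (fun k : ℕ => limsup (fun n : ℕ =>
        P[{ω | ∃ j : ℤ, (k : ℤ) ≤ |j| ∧ |j| ≤ (r n : ℤ) ∧ u n * x < ξ j ω} |
          {ω | u n * y < ξ 0 ω}]) atTop) atTop (𝓝 0)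

/-- Only finitely many terms of `y` exceed any given positive level. -/
def Vanishes (y : ℤ → ℝ) : Prop := ∀ x : ℝ, 0 < x → {j | x < y j}.Finite

/-- `m` is the first location of the maximum of `y`. -/
def IsFirstMax (y : ℤ → ℝ) (m : ℤ) : Prop := (∀ j < m, y j < y m) ∧ ∀ j, y j ≤ y m

/-- `m` is the first location of an exceedance of `1`. -/
def IsFirstExceedance (y : ℤ → ℝ) (m : ℤ) : Prop := 1 < y m ∧ ∀ j < m, y j ≤ 1

lemma IsFirstMax.unique {y : ℤ → ℝ} {m m' : ℤ} (h : IsFirstMax y m) (h' : IsFirstMax y m') :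
    m = m' := by
  rcases lt_trichotomy m m' with hl | hl | hl
  · exact absurd (h'.1 m hl) (not_lt.2 (h.2 m'))
  · exact hl
  · exact absurd (h.1 m' hl) (not_lt.2 (h'.2 m))

lemma IsFirstExceedance.unique {y : ℤ → ℝ} {m m' : ℤ} (h : IsFirstExceedance y m)
    (h' : IsFirstExceedance y m') : m = m' := by
  rcases lt_trichotomy m m' with hl | hl | hl
  · exact absurd h.1 (not_lt.2 (h'.2 m hl))
  · exact hl
  · exact absurd h'.1 (not_lt.2 (h.2 m' hl))

lemma Vanishes.exists_isFirstExceedance {y : ℤ → ℝ} (hy : Vanishes y) {i : ℤ} (hi : 1 < y i) :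
    ∃ m, IsFirstExceedance y m := by
  obtain ⟨m, hm, hmin⟩ := Set.exists_min_image {j | 1 < y j} id (hy 1 one_pos) ⟨i, hi⟩
  exact ⟨m, hm, fun j hj => not_lt.1 fun h1 => absurd (hmin j h1) (not_le.2 hj)⟩

lemma Vanishes.exists_isFirstMax {y : ℤ → ℝ} (hy : Vanishes y) {i : ℤ} (hi : 0 < y i) :
    ∃ m, IsFirstMax y m := by
  have hfin : {j | y i ≤ y j}.Finite :=
    (hy (y i / 2) (by linarith)).subset fun j hj => by
      simp only [Set.mem_ofPred_eq] at hj ⊢; linarith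
  obtain ⟨M, hM, hmax⟩ := Set.exists_max_image _ y hfin ⟨i, le_refl (y i)⟩
  have hmax' : ∀ j, y j ≤ y M := fun j => by
    rcases le_total (y i) (y j) with h | h
    · exact hmax j h
    · exact h.trans hM
  have hfin2 : {j | y M ≤ y j}.Finite := hfin.subset fun j (hj : y M ≤ y j) => le_trans hM hj
  obtain ⟨m, hm, hmin⟩ := Set.exists_min_image _ id hfin2 ⟨M, le_refl (y M)⟩
  refine ⟨m, fun j hj => ?_, fun j => (hmax' j).trans hm⟩
  by_contra hcon
  exact absurd (hmin j (le_trans hm (not_lt.1 hcon))) (not_le.2 hj)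

lemma measurableSet_isFirstMax (m : ℤ) : MeasurableSet {y : ℤ → ℝ | IsFirstMax y m} := by
  have : {y : ℤ → ℝ | IsFirstMax y m} =
      (⋂ j : ℤ, ⋂ _ : j < m, {y | y j < y m}) ∩ ⋂ j : ℤ, {y | y j ≤ y m} := by
    ext y; simp [IsFirstMax]
  rw [this]
  exact (MeasurableSet.iInter fun j => .iInter fun _ =>
    measurableSet_lt (measurable_pi_apply j) (measurable_pi_apply m)).inter
    (.iInter fun j => measurableSet_le (measurable_pi_apply j) (measurable_pi_apply m))

lemma measurableSet_forall_lt_le (m : ℤ) : MeasurableSet {y : ℤ → ℝ | ∀ j < m, y j ≤ 1} := by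
  have : {y : ℤ → ℝ | ∀ j < m, y j ≤ 1} = ⋂ j : ℤ, ⋂ _ : j < m, {y | y j ≤ 1} := by
    ext y; simp
  rw [this]
  exact .iInter fun j => .iInter fun _ => measurableSet_le (measurable_pi_apply j) measurable_const

lemma measurableSet_isFirstExceedance (m : ℤ) :
    MeasurableSet {y : ℤ → ℝ | IsFirstExceedance y m} :=
  (measurableSet_lt measurable_const (measurable_pi_apply m)).inter (measurableSet_forall_lt_le m)

lemma measure_eq_tsum_of_ae_existsUnique {S : Type*} [MeasurableSpace S] {μ : Measure S}
    {A : Set S} (hA : MeasurableSet A) {B : ℤ → Set S} (hB : ∀ m, MeasurableSet (B m))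
    (hd : Pairwise (Function.onFun Disjoint B)) (he : ∀ᵐ ω ∂μ, ω ∈ A → ∃ m, ω ∈ B m) :
    μ A = ∑' m, μ (A ∩ B m) := by
  rw [← measure_iUnion (fun i j hij => (hd hij).mono Set.inter_subset_right Set.inter_subset_right)
    fun m => hA.inter (hB m), ← Set.inter_iUnion]
  refine measure_congr ?_
  filter_upwards [he] with ω hω
  refine propext ⟨fun h => ⟨h, Set.mem_iUnion.2 (hω h)⟩, fun h => h.1⟩

namespace TailPair

/-- An exceedance at distance between `k` and `m` is an open event in finitely many coordinates, so
the portmanteau bound along `u n` transfers anticlustering to `ζ`, uniformly in `m`; then `k → ∞`.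
-/
lemma ae_vanishes (h : TailPair P ξ P' ζ α) {r : ℕ → ℕ} {u : ℕ → ℝ} (hr : Tendsto r atTop atTop)
    (hu : Tendsto u atTop atTop) (hac : AntiCluster P ξ r u) :
    ∀ᵐ ω ∂P', Vanishes fun j => ζ j ω := by
  have key : ∀ x : ℝ, 0 < x → ∀ᵐ ω ∂P', {j | x < ζ j ω}.Finite := by
    intro x hx
    set d : ℕ → ℝ≥0∞ := fun k => limsup (fun n : ℕ =>
        P[{ω | ∃ j : ℤ, (k : ℤ) ≤ |j| ∧ |j| ≤ (r n : ℤ) ∧ u n * x < ξ j ω} |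
          {ω | u n * 1 < ξ 0 ω}]) atTop with hd
    have hd0 : Tendsto d atTop (𝓝 0) := hac x 1 hx one_pos
    have fin : ∀ k m : ℕ, P' {ω | ∃ j : ℤ, (k : ℤ) ≤ |j| ∧ |j| ≤ (m : ℤ) ∧ x < ζ j ω} ≤ d k := by
      intro k m
      let G : Set (ℤ → ℝ) := {y | ∃ j : ℤ, (k : ℤ) ≤ |j| ∧ |j| ≤ (m : ℤ) ∧ x < y j}
      have hG : IsOpen G := by
        have : G = ⋃ j : ℤ, ⋃ _ : (k : ℤ) ≤ |j| ∧ |j| ≤ (m : ℤ), {y | x < y j} := by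
          ext y; simp [G, and_assoc]
        rw [this]
        exact isOpen_iUnion fun j => isOpen_iUnion fun _ =>
          isOpen_lt continuous_const (continuous_apply j)
      have hJ : DependsOnCoords G (Finset.Icc (-m : ℤ) m) := by
        rintro y y' hy ⟨j, h1, h2, h3⟩
        exact ⟨j, h1, h2, by rwa [← hy j (by rw [Finset.mem_Icc]; exact abs_le.1 h2)]⟩
      refine (h.measure_open_le_liminf hG hJ).trans ?_
      refine (liminf_le_liminf_of_le hu).trans ?_
      change liminf ((fun x : ℝ => P[{ω | (fun j => x⁻¹ * ξ j ω) ∈ G} | {ω | x < ξ 0 ω}]) ∘ u) atTop ≤ _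
      refine le_trans liminf_le_limsup (limsup_le_limsup ?_)
      filter_upwards [hu.eventually_gt_atTop 0, hr.eventually_ge_atTop m] with n hun hrn
      simp only [Function.comp, mul_one]
      refine measure_mono ?_
      rintro ω ⟨j, h1, h2, h3⟩
      refine ⟨j, h1, h2.trans (by exact_mod_cast hrn), ?_⟩
      have h4 : x < (u n)⁻¹ * ξ j ω := h3
      rw [inv_mul_eq_div, lt_div_iff₀ hun] at h4
      linarith
    have all : ∀ k : ℕ, P' {ω | ∃ j : ℤ, (k : ℤ) ≤ |j| ∧ x < ζ j ω} ≤ d k := by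
      intro k
      have e : {ω | ∃ j : ℤ, (k : ℤ) ≤ |j| ∧ x < ζ j ω} =
          ⋃ m : ℕ, {ω | ∃ j : ℤ, (k : ℤ) ≤ |j| ∧ |j| ≤ (m : ℤ) ∧ x < ζ j ω} := by
        ext ω
        simp only [Set.mem_ofPred_eq, Set.mem_iUnion]
        constructor
        · rintro ⟨j, h1, h2⟩
          exact ⟨j.natAbs, j, h1, by simp, h2⟩
        · rintro ⟨m, j, h1, -, h2⟩
          exact ⟨j, h1, h2⟩
      rw [e, Monotone.measure_iUnion]
      · exact iSup_le fun m => fin k m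
      · rintro m m' hm ω ⟨j, h1, h2, h3⟩
        exact ⟨j, h1, h2.trans (by exact_mod_cast hm), h3⟩
    rw [ae_iff]
    refine le_antisymm (ge_of_tendsto' hd0 fun k => (measure_mono ?_).trans (all k)) bot_le
    intro ω hω
    by_contra hcon
    apply hω
    refine (Set.finite_Icc (-(k : ℤ)) k).subset fun j hj => ?_
    rw [Set.mem_Icc, ← abs_le]
    by_contra hk
    exact hcon ⟨j, (not_le.1 hk).le, hj⟩
  have : ∀ᵐ ω ∂P', ∀ n : ℕ, {j | (1 / ((n : ℝ) + 1)) < ζ j ω}.Finite :=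
    ae_all_iff.2 fun n => key _ (by positivity)
  filter_upwards [this] with ω hω x hx
  obtain ⟨n, hn⟩ := exists_nat_one_div_lt hx
  exact (hω n).subset fun j (hj : x < ζ j ω) => hn.trans hj

lemma ae_exists_isFirstMax (h : TailPair P ξ P' ζ α) (hv : ∀ᵐ ω ∂P', Vanishes fun j => ζ j ω) :
    ∀ᵐ ω ∂P', ∃ m, IsFirstMax (fun j => ζ j ω) m := by
  filter_upwards [hv, h.one_lt_ae] with ω h1 h2
  exact h1.exists_isFirstMax (i := 0) (by linarith)

/-- A maximum at `m` is at least `ζ 0 > 1`, so the exceedance required at time `m` by the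
time-change formula is automatic. -/
lemma measure_isFirstMax_shift (h : TailPair P ξ P' ζ α) (m : ℤ) {A : Set (ℤ → ℝ)}
    (hA : MeasurableSet A) :
    P' {ω | (fun j => ζ j ω) ∈ A ∧ IsFirstMax (fun j => ζ j ω) m} =
      P' {ω | (fun j => ζ (j - m) ω) ∈ A ∧ IsFirstMax (fun j => ζ j ω) 0 ∧ 1 < ζ (-m) ω} := by
  have h1 := h.shift m (hA.inter (measurableSet_isFirstMax m))
  calc _ = P' {ω | (fun j => ζ j ω) ∈ A ∩ {y | IsFirstMax y m} ∧ 1 < ζ m ω} := by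
        refine measure_congr ?_
        filter_upwards [h.one_lt_ae] with ω hω
        refine propext ⟨fun hx => ⟨hx, ?_⟩, fun hx => hx.1⟩
        exact lt_of_lt_of_le hω (hx.2.2 0)
    _ = _ := h1
    _ = _ := by
        congr 1; ext ω
        simp only [Set.mem_inter_iff, Set.mem_ofPred_eq, and_assoc]
        refine and_congr_right fun _ => and_congr_left fun _ => ?_
        constructor
        · rintro ⟨h1, h2⟩
          refine ⟨fun j hj => ?_, fun j => ?_⟩
          · simpa using h1 (j + m) (by linarith)
          · simpa using h2 (j + m)
        · rintro ⟨h1, h2⟩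
          refine ⟨fun j hj => ?_, fun j => ?_⟩
          · simpa using h1 (j - m) (by linarith)
          · simpa using h2 (j - m)

/-- The event that the first maximum of the tail process is at `0` has positive probability. -/
lemma measure_isFirstMax_pos (h : TailPair P ξ P' ζ α)
    (hv : ∀ᵐ ω ∂P', Vanishes fun j => ζ j ω) :
    0 < P' {ω | IsFirstMax (fun j => ζ j ω) 0} := by
  rw [pos_iff_ne_zero]
  intro h0
  -- The time change embeds a first maximum at any `m` into a first maximum at `0`, so nullity at
  -- `0` would leave no first maximum anywhere.
  have h1 : ∀ m, P' {ω | IsFirstMax (fun j => ζ j ω) m} = 0 := by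
    intro m
    have := h.measure_isFirstMax_shift m MeasurableSet.univ
    simp only [Set.mem_univ, true_and] at this
    rw [this]
    exact measure_mono_null (fun ω hω => hω.1) h0
  have h2 : ∀ᵐ ω ∂P', ∀ m, ¬ IsFirstMax (fun j => ζ j ω) m :=
    ae_all_iff.2 fun m => by rw [ae_iff]; simpa using h1 m
  have : ∀ᵐ ω ∂P', False := by
    filter_upwards [h2, h.ae_exists_isFirstMax hv] with ω ha hb
    exact hb.elim fun m hm => ha m hm
  rw [ae_iff] at this
  simp at this

/-- Anchoring at the first exceedance and anchoring at the first maximum give shift-invariant events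
the same probability. -/
theorem measure_anchor_eq (h : TailPair P ξ P' ζ α) (hv : ∀ᵐ ω ∂P', Vanishes fun j => ζ j ω)
    {H : Set (ℤ → ℝ)} (hH : MeasurableSet H)
    (hinv : ∀ (y : ℤ → ℝ) (a : ℤ), (fun j => y (j - a)) ∈ H ↔ y ∈ H) :
    P' {ω | (fun j => ζ j ω) ∈ H ∧ ∀ j < 0, ζ j ω ≤ 1} =
      P' {ω | (fun j => ζ j ω) ∈ H ∧ IsFirstMax (fun j => ζ j ω) 0} := by
  have hp := h.measurable_path'
  have hM : ∀ m, MeasurableSet {ω | IsFirstMax (fun j => ζ j ω) m} := fun m =>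
    hp (measurableSet_isFirstMax m)
  have hE : ∀ m, MeasurableSet {ω | IsFirstExceedance (fun j => ζ j ω) m} := fun m =>
    hp (measurableSet_isFirstExceedance m)
  -- The left event is split by the location `m` of the first maximum, the right one by the location
  -- `-m` of the first exceedance; the time change matches the terms one by one.
  rw [measure_eq_tsum_of_ae_existsUnique (A := {ω | (fun j => ζ j ω) ∈ H ∧ ∀ j < 0, ζ j ω ≤ 1})
      (hp (hH.inter (measurableSet_forall_lt_le 0))) hM
      (fun i j hij => Set.disjoint_left.2 fun ω h1 h2 => hij (h1.unique h2))
      ((h.ae_exists_isFirstMax hv).mono fun ω hω _ => hω),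
    measure_eq_tsum_of_ae_existsUnique
      (A := {ω | (fun j => ζ j ω) ∈ H ∧ IsFirstMax (fun j => ζ j ω) 0})
      (B := fun m => {ω | IsFirstExceedance (fun j => ζ j ω) (-m)})
      (hp (hH.inter (measurableSet_isFirstMax 0))) (fun m => hE (-m))
      (fun i j hij => Set.disjoint_left.2 fun ω h1 h2 => hij (neg_inj.1
        (IsFirstExceedance.unique (y := fun j => ζ j ω) h1 h2)))]
  · refine tsum_congr fun m => ?_
    have h1 := h.measure_isFirstMax_shift m (hH.inter (measurableSet_forall_lt_le 0))
    refine h1.trans ?_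
    congr 1; ext ω
    have e : (∀ j < 0, ζ (j - m) ω ≤ 1) ↔ ∀ j < -m, ζ j ω ≤ 1 :=
      ⟨fun hx j hj => by simpa using hx (j + m) (by linarith), fun hx j hj => hx _ (by linarith)⟩
    simp only [Set.mem_inter_iff, Set.mem_ofPred_eq, IsFirstExceedance, hinv (fun j => ζ j ω), e]
    tauto
  · filter_upwards [hv, h.one_lt_ae] with ω h1 h2 _
    obtain ⟨m, hm⟩ := h1.exists_isFirstExceedance (i := 0) h2
    exact ⟨-m, by simpa using hm⟩

end TailPair

/-! ### Pareto modulus, absence of atoms and independence of the angular part -/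

lemma not_countable_Ioo {a b : ℝ} (h : a < b) : ¬ (Set.Ioo a b).Countable := by
  rw [← Cardinal.le_aleph0_iff_set_countable, Cardinal.mk_Ioo_real h]
  exact not_le.2 Cardinal.aleph0_lt_continuum

namespace TailPair

lemma measure_lt_zero (h : TailPair P ξ P' ζ α) {s : ℝ} (hs : 1 ≤ s) :
    P' {ω | s < ζ 0 ω} = ENNReal.ofReal (s ^ (-α)) := by
  simpa using h.scaling hs MeasurableSet.univ

/-- The marginals of the tail process have no atoms away from `0`. -/
lemma measure_eq_zero (h : TailPair P ξ P' ζ α) (j : ℤ) (c : ℝ) (hc : c ≠ 0) :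
    P' {ω | ζ j ω = c} = 0 := by
  by_contra hne
  -- Staying strictly above level `1` leaves an interval of scales `s`; by scaling, an atom at `c`
  -- creates an atom at `c / s` for each of them, which is uncountably many.
  have h1 : ∃ n : ℕ, P' {ω | ζ j ω = c ∧ 1 + 1 / ((n : ℝ) + 1) < ζ 0 ω} ≠ 0 := by
    by_contra! hcon
    refine hne (measure_mono_null ?_ (measure_union_null (measure_iUnion_null hcon)
      (ae_iff.1 h.one_lt_ae)))
    intro ω hω
    by_cases h0 : 1 < ζ 0 ω
    · obtain ⟨n, hn⟩ := exists_nat_one_div_lt (sub_pos.2 h0)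
      exact Or.inl (Set.mem_iUnion.2 ⟨n, hω, by linarith⟩)
    · exact Or.inr h0
  obtain ⟨n, hn⟩ := h1
  set s₀ : ℝ := 1 + 1 / ((n : ℝ) + 1) with hs₀
  have hs1 : 1 < s₀ := by
    have : (0 : ℝ) < 1 / ((n : ℝ) + 1) := by positivity
    linarith
  have hlev : ∀ s ∈ Set.Ioo 1 s₀, c / s ∈ {t : ℝ | 0 < P' {ω | ζ j ω = t}} := by
    rintro s ⟨hsl, hsr⟩
    have hA : MeasurableSet {y : ℤ → ℝ | y j = c} := 
      measurableSet_eq_fun (measurable_pi_apply j) measurable_const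
    have h2 := h.scaling hsl.le hA
    have h3 : 0 < P' {ω | (fun j => ζ j ω) ∈ {y : ℤ → ℝ | y j = c} ∧ s < ζ 0 ω} :=
      lt_of_lt_of_le (pos_iff_ne_zero.2 hn) (measure_mono fun ω hω => ⟨hω.1, hsr.trans hω.2⟩)
    rw [h2] at h3
    have h4 := pos_of_mul_pos_right h3 bot_le
    refine lt_of_lt_of_le h4 (measure_mono fun ω hω => ?_)
    have h5 : s * ζ j ω = c := hω
    have : s ≠ 0 := by linarith
    simp only [Set.mem_ofPred_eq]
    rw [eq_div_iff this, mul_comm]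
    exact h5
  have hcount := Measure.countable_meas_level_set_pos (μ := P') (h.meas' j)
  have hinj : Set.InjOn (fun s : ℝ => c / s) (Set.Ioo 1 s₀) := by
    rintro s ⟨hs, _⟩ t ⟨ht, _⟩ hst
    simp only at hst
    rw [div_eq_div_iff (by linarith) (by linarith)] at hst
    exact (mul_left_cancel₀ hc hst).symm
  have hc2 : (Set.Ioo 1 s₀).Countable :=
    Set.MapsTo.countable_of_injOn (fun s hs => hlev s hs) hinj hcount
  exact not_countable_Ioo hs1 hc2

lemma measure_le_zero (h : TailPair P ξ P' ζ α) {s : ℝ} (hs : 1 ≤ s) :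
    P' {ω | s ≤ ζ 0 ω} = ENNReal.ofReal (s ^ (-α)) := by
  rw [← h.measure_lt_zero hs]
  refine measure_congr ?_
  have h0 : ∀ᵐ ω ∂P', ζ 0 ω ≠ s := by
    rw [ae_iff]; simpa using h.measure_eq_zero 0 s (by linarith)
  filter_upwards [h0] with ω hω
  exact propext ⟨fun hx => lt_of_le_of_ne hx (Ne.symm hω), fun hx => le_of_lt hx⟩

/-- The modulus at `0` is independent of the angular part of the tail process. -/
lemma indepFun (h : TailPair P ξ P' ζ α) {W : (ℤ → ℝ) → ℝ≥0∞} (hW : Measurable W)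
    (hinv : ∀ (s : ℝ) (y : ℤ → ℝ), 0 < s → W (fun j => s * y j) = W y) :
    IndepFun (ζ 0) (fun ω => W fun j => ζ j ω) P' := by
  have hWm : Measurable (fun ω => W fun j => ζ j ω) := hW.comp h.measurable_path'
  refine IndepSets.indep (p1 := (Set.preimage (ζ 0)) '' (Set.range Set.Ioi))
    (p2 := {t | MeasurableSet[MeasurableSpace.comap (fun ω => W fun j => ζ j ω) inferInstance] t})
    (h.meas' 0).comap_le hWm.comap_le ?_ 
    (@MeasurableSpace.isPiSystem_measurableSet _
      (MeasurableSpace.comap (fun ω => W fun j => ζ j ω) inferInstance)) ?_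
    (@MeasurableSpace.generateFrom_measurableSet _
      (MeasurableSpace.comap (fun ω => W fun j => ζ j ω) inferInstance)).symm ?_
  · rintro _ ⟨_, ⟨s, rfl⟩, rfl⟩ _ ⟨_, ⟨t, rfl⟩, rfl⟩ _
    exact ⟨_, ⟨max s t, rfl⟩, by rw [← Set.preimage_inter, Set.Ioi_inter_Ioi]⟩
  · rw [← MeasurableSpace.comap_generateFrom, ← borel_eq_generateFrom_Ioi]
    rfl
  · rw [IndepSets_iff]
    rintro _ _ ⟨_, ⟨s, rfl⟩, rfl⟩ ⟨B, hB, rfl⟩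
    have key : ∀ s : ℝ, 1 ≤ s → P' (ζ 0 ⁻¹' Set.Ioi s ∩ (fun ω => W fun j => ζ j ω) ⁻¹' B) =
        P' (ζ 0 ⁻¹' Set.Ioi s) * P' ((fun ω => W fun j => ζ j ω) ⁻¹' B) := by
      intro s hs
      have h1 := h.scaling hs (hW hB)
      have h2 : P' (ζ 0 ⁻¹' Set.Ioi s) = _ := h.measure_lt_zero hs
      rw [h2, Set.inter_comm]
      refine h1.trans ?_
      congr 2
      ext ω
      simp only [Set.mem_preimage, Set.mem_ofPred_eq, hinv s _ (by linarith : (0 : ℝ) < s)]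
    rcases le_total 1 s with hs | hs
    · exact key s hs
    -- Below `1` the half-line event is almost surely the one at level `1`.
    · have h3 : ζ 0 ⁻¹' Set.Ioi s =ᵐ[P'] ζ 0 ⁻¹' Set.Ioi 1 := by
        filter_upwards [h.one_lt_ae] with ω hω
        exact propext ⟨fun _ => hω, fun _ => lt_of_le_of_lt hs hω⟩
      have h4 : P' (ζ 0 ⁻¹' Set.Ioi s ∩ (fun ω => W fun j => ζ j ω) ⁻¹' B) =
          P' (ζ 0 ⁻¹' Set.Ioi 1 ∩ (fun ω => W fun j => ζ j ω) ⁻¹' B) :=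
        measure_congr (h3.inter (ae_eq_refl _))
      rw [h4, measure_congr h3]
      exact key 1 le_rfl

/-- Integrating out the modulus at `0`. -/
lemma measure_mem_eq_lintegral (h : TailPair P ξ P' ζ α) {W : (ℤ → ℝ) → ℝ≥0∞} (hW : Measurable W)
    (hinv : ∀ (s : ℝ) (y : ℤ → ℝ), 0 < s → W (fun j => s * y j) = W y)
    {S : Set (ℝ × ℝ≥0∞)} (hS : MeasurableSet S) :
    P' {ω | (ζ 0 ω, W fun j => ζ j ω) ∈ S} =
      ∫⁻ ω, P' {ω' | (ζ 0 ω', W fun j => ζ j ω) ∈ S} ∂P' := by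
  have hWm : Measurable (fun ω => W fun j => ζ j ω) := hW.comp h.measurable_path'
  have h1 := (indepFun_iff_map_prod_eq_prod_map_map (h.meas' 0).aemeasurable hWm.aemeasurable).1
    (h.indepFun hW hinv)
  have h2 := congrArg (fun m => m S) h1
  have : IsProbabilityMeasure (P'.map (ζ 0)) :=
    Measure.isProbabilityMeasure_map (h.meas' 0).aemeasurable
  have : IsProbabilityMeasure (P'.map (fun ω => W fun j => ζ j ω)) :=
    Measure.isProbabilityMeasure_map hWm.aemeasurable
  rw [Measure.map_apply ((h.meas' 0).prodMk hWm) hS, Measure.prod_apply_symm hS,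
    lintegral_map (measurable_measure_prodMk_right hS) hWm] at h2
  refine h2.trans (lintegral_congr fun ω => ?_)
  rw [Measure.map_apply (h.meas' 0) (measurable_prodMk_right hS)]
  rfl

/-- The Pareto tail gives equality when `1 ≤ c / w`; otherwise the right side is at least `1`. -/
lemma measure_le_mul (h : TailPair P ξ P' ζ α) {c : ℝ} (hc : 0 < c) (w : ℝ≥0∞) :
    P' {ω | ENNReal.ofReal c ≤ ENNReal.ofReal (ζ 0 ω) * w} ≤ (w / ENNReal.ofReal c) ^ α := by
  rcases eq_or_ne w ⊤ with rfl | hw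
  · rw [ENNReal.top_div_of_ne_top ENNReal.ofReal_ne_top, ENNReal.top_rpow_of_pos h.pos]
    exact le_top
  lift w to NNReal using hw
  rcases eq_or_ne w 0 with rfl | hw0
  · simp [hc.not_ge]
  have hwp : (0 : ℝ) < w := by positivity
  have e : (((w : ℝ≥0∞) / ENNReal.ofReal c)) ^ α = ENNReal.ofReal ((c / w) ^ (-α)) := by
    rw [← ENNReal.ofReal_coe_nnreal, ← ENNReal.ofReal_div_of_pos hc,
      ENNReal.ofReal_rpow_of_pos (by positivity), Real.rpow_neg (by positivity),
      ← Real.inv_rpow (by positivity), inv_div]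
  have hset : {ω | ENNReal.ofReal c ≤ ENNReal.ofReal (ζ 0 ω) * w} = {ω | c / w ≤ ζ 0 ω} := by
    ext ω
    simp only [Set.mem_ofPred_eq]
    rw [← ENNReal.ofReal_coe_nnreal, ← ENNReal.ofReal_mul (h.nonneg' 0 ω),
      ENNReal.ofReal_le_ofReal_iff (mul_nonneg (h.nonneg' 0 ω) hwp.le), div_le_iff₀ hwp]
  rw [e, hset]
  rcases le_total 1 (c / w) with h1 | h1
  · rw [h.measure_le_zero h1]
  · refine prob_le_one.trans ?_
    rw [← ENNReal.ofReal_one]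
    exact ENNReal.ofReal_le_ofReal (Real.one_le_rpow_of_pos_of_le_one_of_nonpos (by positivity) h1
      (neg_nonpos.2 h.pos.le))

/-- The condition `w ≤ c` keeps the threshold `c / w` at or above `1`, where the Pareto tail is
exact. It is why the angular sum has to be capped below. -/
lemma le_measure_lt_mul (h : TailPair P ξ P' ζ α) {c : ℝ} (hc : 0 < c) {w : ℝ≥0∞}
    (hwc : w ≤ ENNReal.ofReal c) :
    (w / ENNReal.ofReal c) ^ α ≤ P' {ω | ENNReal.ofReal c < ENNReal.ofReal (ζ 0 ω) * w} := by
  lift w to NNReal using ne_top_of_le_ne_top ENNReal.ofReal_ne_top hwc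
  rcases eq_or_ne w 0 with rfl | hw0
  · simp [h.pos]
  have hwp : (0 : ℝ) < w := by positivity
  have hwc' : (w : ℝ) ≤ c := by
    rwa [← ENNReal.ofReal_coe_nnreal, ENNReal.ofReal_le_ofReal_iff hc.le] at hwc
  have e : (((w : ℝ≥0∞) / ENNReal.ofReal c)) ^ α = ENNReal.ofReal ((c / w) ^ (-α)) := by
    rw [← ENNReal.ofReal_coe_nnreal, ← ENNReal.ofReal_div_of_pos hc,
      ENNReal.ofReal_rpow_of_pos (by positivity), Real.rpow_neg (by positivity),
      ← Real.inv_rpow (by positivity), inv_div]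
  rw [e, ← h.measure_lt_zero ((one_le_div hwp).2 hwc')]
  refine measure_mono fun ω (hω : c / w < ζ 0 ω) => ?_
  simp only [Set.mem_ofPred_eq]
  rw [div_lt_iff₀ hwp] at hω
  rwa [← ENNReal.ofReal_coe_nnreal, ← ENNReal.ofReal_mul (h.nonneg' 0 ω),
    ENNReal.ofReal_lt_ofReal_iff_of_nonneg hc.le]

end TailPair

/-! ### The cluster constant as a moment of the angular sum -/

/-- The sum of the angular part of a sequence whose first maximum is at `0`. -/
noncomputable def angularSum (y : ℤ → ℝ) : ℝ≥0∞ :=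
  {y : ℤ → ℝ | IsFirstMax y 0}.indicator (fun y => ∑' j : ℤ, ENNReal.ofReal (y j / y 0)) y

/-- A truncated version of `angularSum`, with small terms removed and capped at `b`. -/
noncomputable def truncAngularSum (δ b : ℝ) (y : ℤ → ℝ) : ℝ≥0∞ :=
  {y : ℤ → ℝ | IsFirstMax y 0}.indicator (fun y =>
    min (∑' j : ℤ, ENNReal.ofReal (if δ < y j / y 0 then y j / y 0 else 0)) (ENNReal.ofReal b)) y

lemma angularSum_of_isFirstMax {y : ℤ → ℝ} (h : IsFirstMax y 0) :
    angularSum y = ∑' j : ℤ, ENNReal.ofReal (y j / y 0) :=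
  Set.indicator_of_mem (s := {y : ℤ → ℝ | IsFirstMax y 0}) h _

lemma angularSum_of_not_isFirstMax {y : ℤ → ℝ} (h : ¬ IsFirstMax y 0) : angularSum y = 0 :=
  Set.indicator_of_notMem (s := {y : ℤ → ℝ | IsFirstMax y 0}) h _

lemma truncAngularSum_of_isFirstMax (δ b : ℝ) {y : ℤ → ℝ} (h : IsFirstMax y 0) :
    truncAngularSum δ b y = min (∑' j : ℤ, ENNReal.ofReal (if δ < y j / y 0 then y j / y 0 else 0))
      (ENNReal.ofReal b) :=
  Set.indicator_of_mem (s := {y : ℤ → ℝ | IsFirstMax y 0}) h _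

lemma truncAngularSum_of_not_isFirstMax (δ b : ℝ) {y : ℤ → ℝ} (h : ¬ IsFirstMax y 0) :
    truncAngularSum δ b y = 0 :=
  Set.indicator_of_notMem (s := {y : ℤ → ℝ | IsFirstMax y 0}) h _

lemma measurable_angularSum : Measurable angularSum := by
  refine Measurable.indicator ?_ (measurableSet_isFirstMax 0)
  exact Measurable.tsum fun j => by fun_prop

lemma measurable_truncAngularSum (δ b : ℝ) : Measurable (truncAngularSum δ b) := by
  refine Measurable.indicator (Measurable.min ?_ measurable_const) (measurableSet_isFirstMax 0)
  refine Measurable.tsum fun j => ENNReal.measurable_ofReal.comp ?_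
  have h1 : Measurable fun y : ℤ → ℝ => y j / y 0 := by fun_prop
  exact Measurable.ite (measurableSet_lt measurable_const h1) h1 measurable_const

lemma isFirstMax_smul {s : ℝ} (hs : 0 < s) (y : ℤ → ℝ) (m : ℤ) :
    IsFirstMax (fun j => s * y j) m ↔ IsFirstMax y m := by
  simp [IsFirstMax, hs]

lemma angularSum_smul (s : ℝ) (y : ℤ → ℝ) (hs : 0 < s) :
    angularSum (fun j => s * y j) = angularSum y := by
  by_cases h : IsFirstMax y 0
  · simp [angularSum, Set.indicator, isFirstMax_smul hs, h, mul_div_mul_left _ _ hs.ne']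
  · simp [angularSum, Set.indicator, isFirstMax_smul hs, h]

lemma truncAngularSum_smul (δ b s : ℝ) (y : ℤ → ℝ) (hs : 0 < s) :
    truncAngularSum δ b (fun j => s * y j) = truncAngularSum δ b y := by
  by_cases h : IsFirstMax y 0
  · simp [truncAngularSum, Set.indicator, isFirstMax_smul hs, h, mul_div_mul_left _ _ hs.ne']
  · simp [truncAngularSum, Set.indicator, isFirstMax_smul hs, h]

/-- The limit constant `E[1{first maximum at 0} (∑_j ζ_j / ζ_0)^α]`. -/
noncomputable def clusterConst (P' : Measure Ω') (ζ : ℤ → Ω' → ℝ) (α : ℝ) : ℝ≥0∞ :=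
  ∫⁻ ω, angularSum (fun j => ζ j ω) ^ α ∂P'

namespace TailPair

/-- Restoring the terms below `1` only enlarges the sum, which becomes `ζ 0` times the angular sum;
the independent Pareto factor is then integrated out. -/
lemma measure_sum_ge_le (h : TailPair P ξ P' ζ α) {c : ℝ} (hc : 0 < c) :
    P' {ω | IsFirstMax (fun j => ζ j ω) 0 ∧
      ENNReal.ofReal c ≤ ∑' j : ℤ, ENNReal.ofReal (if 1 ≤ ζ j ω then ζ j ω else 0)} ≤
      clusterConst P' ζ α / ENNReal.ofReal c ^ α := by
  let S : Set (ℝ × ℝ≥0∞) := {p | ENNReal.ofReal c ≤ ENNReal.ofReal p.1 * p.2}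
  have hS : MeasurableSet S := measurableSet_le measurable_const (by fun_prop)
  calc _ ≤ P' {ω | (ζ 0 ω, angularSum fun j => ζ j ω) ∈ S} := by
        refine measure_mono_ae ?_
        filter_upwards [h.one_lt_ae] with ω hω
        rintro ⟨h1, h2⟩
        have h0 : 0 < ζ 0 ω := by linarith
        change ENNReal.ofReal c ≤ ENNReal.ofReal (ζ 0 ω) * angularSum fun j => ζ j ω
        refine h2.trans ?_
        rw [angularSum_of_isFirstMax h1, ← ENNReal.tsum_mul_left]
        refine ENNReal.tsum_le_tsum fun j => ?_
        rw [← ENNReal.ofReal_mul h0.le, mul_div_cancel₀ _ h0.ne']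
        refine ENNReal.ofReal_le_ofReal ?_
        split_ifs
        · exact le_rfl
        · exact h.nonneg' j ω
    _ = ∫⁻ ω, P' {ω' | (ζ 0 ω', angularSum fun j => ζ j ω) ∈ S} ∂P' :=
        h.measure_mem_eq_lintegral measurable_angularSum (fun s y hs => angularSum_smul s y hs) hS
    _ ≤ ∫⁻ ω, angularSum (fun j => ζ j ω) ^ α / ENNReal.ofReal c ^ α ∂P' := by
        refine lintegral_mono fun ω => ?_
        rw [← ENNReal.div_rpow_of_nonneg _ _ h.pos.le]
        exact h.measure_le_mul hc _
    _ = _ := by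
        simp only [ENNReal.div_eq_inv_mul]
        have hm : Measurable fun ω => angularSum (fun j => ζ j ω) ^ α :=
          (measurable_angularSum.comp h.measurable_path').pow_const α
        rw [lintegral_const_mul _ hm]
        rfl

/-- The cap `c * δ` plays two roles. It is at most `c`, so the Pareto tail is exact; and a capped
product exceeding `c` forces `ζ 0 * δ > 1`, so every term of ratio above `δ` is a genuine exceedance
of `1`. -/
lemma lintegral_truncAngularSum_le (h : TailPair P ξ P' ζ α) {c δ : ℝ} (hc : 0 < c)
    (hδ1 : δ ≤ 1) :
    ∫⁻ ω, truncAngularSum δ (c * δ) (fun j => ζ j ω) ^ α ∂P' ≤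
      ENNReal.ofReal c ^ α * P' {ω | IsFirstMax (fun j => ζ j ω) 0 ∧
        ENNReal.ofReal c < ∑' j : ℤ, ENNReal.ofReal (if 1 < ζ j ω then ζ j ω else 0)} := by
  let S : Set (ℝ × ℝ≥0∞) := {p | ENNReal.ofReal c < ENNReal.ofReal p.1 * p.2}
  have hS : MeasurableSet S := measurableSet_lt measurable_const (by fun_prop)
  have hc0 : ENNReal.ofReal c ≠ 0 := by simpa using hc
  have hcα0 : ENNReal.ofReal c ^ α ≠ 0 := by simp [hc0, ENNReal.rpow_eq_zero_iff]
  have hcαt : ENNReal.ofReal c ^ α ≠ ⊤ := ENNReal.rpow_ne_top_of_nonneg h.pos.le ENNReal.ofReal_ne_top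
  have key : ∫⁻ ω, truncAngularSum δ (c * δ) (fun j => ζ j ω) ^ α / ENNReal.ofReal c ^ α ∂P' ≤
      P' {ω | IsFirstMax (fun j => ζ j ω) 0 ∧
        ENNReal.ofReal c < ∑' j : ℤ, ENNReal.ofReal (if 1 < ζ j ω then ζ j ω else 0)} := by
    calc _ ≤ ∫⁻ ω, P' {ω' | (ζ 0 ω', truncAngularSum δ (c * δ) fun j => ζ j ω) ∈ S} ∂P' := by
          refine lintegral_mono fun ω => ?_
          simp only
          rw [← ENNReal.div_rpow_of_nonneg _ _ h.pos.le]
          refine h.le_measure_lt_mul hc ?_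
          by_cases hF : IsFirstMax (fun j => ζ j ω) 0
          · rw [truncAngularSum_of_isFirstMax _ _ hF]
            exact (min_le_right _ _).trans (ENNReal.ofReal_le_ofReal (by nlinarith))
          · rw [truncAngularSum_of_not_isFirstMax _ _ hF]
            exact bot_le
      _ = P' {ω | (ζ 0 ω, truncAngularSum δ (c * δ) fun j => ζ j ω) ∈ S} :=
          (h.measure_mem_eq_lintegral (measurable_truncAngularSum _ _)
            (fun s y hs => truncAngularSum_smul _ _ s y hs) hS).symm
      _ ≤ _ := by
          refine measure_mono_ae ?_
          filter_upwards [h.one_lt_ae] with ω hω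
          intro (h1 : ENNReal.ofReal c < ENNReal.ofReal (ζ 0 ω) * truncAngularSum δ (c * δ) fun j => ζ j ω)
          have h0 : 0 < ζ 0 ω := by linarith
          by_cases hF : IsFirstMax (fun j => ζ j ω) 0
          swap
          · rw [truncAngularSum_of_not_isFirstMax _ _ hF] at h1
            simp at h1
          refine ⟨hF, ?_⟩
          rw [truncAngularSum_of_isFirstMax _ _ hF] at h1
          have h2 := h1.trans_le (mul_le_mul_right (min_le_right _ _) _)
          rw [← ENNReal.ofReal_mul h0.le, ENNReal.ofReal_lt_ofReal_iff_of_nonneg hc.le] at h2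
          have h3 : 1 < ζ 0 ω * δ := by nlinarith
          refine (h1.trans_le (mul_le_mul_right (min_le_left _ _) _)).trans_le ?_
          rw [← ENNReal.tsum_mul_left]
          refine ENNReal.tsum_le_tsum fun j => ?_
          rw [← ENNReal.ofReal_mul h0.le]
          refine ENNReal.ofReal_le_ofReal ?_
          by_cases hj : δ < ζ j ω / ζ 0 ω
          · have h4 : 1 < ζ j ω := by
              rw [lt_div_iff₀ h0] at hj
              linarith [mul_comm δ (ζ 0 ω)]
            simp only [hj, h4, if_true]
            rw [mul_div_cancel₀ _ h0.ne']
          · simp only [hj, if_false, mul_zero]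
            split_ifs
            · exact h.nonneg' j ω
            · exact le_rfl
  simp only [ENNReal.div_eq_inv_mul] at key
  have hm : Measurable fun ω => truncAngularSum δ (c * δ) (fun j => ζ j ω) ^ α :=
    ((measurable_truncAngularSum _ _).comp h.measurable_path').pow_const α
  rw [lintegral_const_mul _ hm,
    ENNReal.inv_mul_le_iff hcα0 hcαt] at key
  exact key

/-- Fatou with `δ = 1 / (k + 1)` and `c = (k + 1) ^ 2`: the cutoff `δ` tends to `0` while the cap `c
* δ = k + 1` tends to infinity. -/
lemma exists_lt_of_lt_clusterConst (h : TailPair P ξ P' ζ α) {b : ℝ≥0∞}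
    (hb : b < clusterConst P' ζ α) :
    ∃ c : ℝ, 0 < c ∧ b < ENNReal.ofReal c ^ α * P' {ω | IsFirstMax (fun j => ζ j ω) 0 ∧
        ENNReal.ofReal c < ∑' j : ℤ, ENNReal.ofReal (if 1 < ζ j ω then ζ j ω else 0)} := by
  let w : ℕ → (ℤ → ℝ) → ℝ≥0∞ := fun k =>
    truncAngularSum (1 / ((k : ℝ) + 1)) (((k : ℝ) + 1) ^ 2 * (1 / ((k : ℝ) + 1)))
  have hpt : ∀ y : ℤ → ℝ, angularSum y ≤ liminf (fun k => w k y) atTop := by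
    intro y
    by_cases hF : IsFirstMax y 0
    swap
    · rw [angularSum_of_not_isFirstMax hF]; exact bot_le
    rw [angularSum_of_isFirstMax hF]
    refine le_of_forall_lt_imp_le_of_dense fun a ha => ?_
    refine le_liminf_of_le (by isBoundedDefault) ?_
    -- Finitely many terms already exceed `a`, and the cutoff eventually spares every positive one
    -- among them.
    obtain ⟨F, hFa⟩ := ((ENNReal.summable.hasSum.eventually (lt_mem_nhds ha))).exists
    have e1 : ∀ᶠ k : ℕ in atTop, ∀ j ∈ F, 0 < y j / y 0 → 1 / ((k : ℝ) + 1) < y j / y 0 := by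
      rw [Filter.eventually_all_finset]
      intro j _
      by_cases hj : 0 < y j / y 0
      · filter_upwards [tendsto_one_div_add_atTop_nhds_zero_nat.eventually (gt_mem_nhds hj)] with k hk _
        exact hk
      · exact Eventually.of_forall fun k hk => absurd hk hj
    have e2 : ∀ᶠ k : ℕ in atTop, a ≤ ENNReal.ofReal ((k : ℝ) + 1) := by
      have ht : Tendsto (fun k : ℕ => ENNReal.ofReal ((k : ℝ) + 1)) atTop (𝓝 ⊤) :=
        ENNReal.tendsto_ofReal_atTop.comp
          (tendsto_atTop_add_const_right _ _ tendsto_natCast_atTop_atTop)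
      exact (ht.eventually (lt_mem_nhds (lt_top_of_lt ha))).mono fun _ => le_of_lt
    filter_upwards [e1, e2] with k h1 h2
    rw [show w k y = _ from truncAngularSum_of_isFirstMax _ _ hF]
    refine le_min ?_ ?_
    · refine hFa.le.trans (le_trans (Finset.sum_le_sum fun j hj => ?_) (ENNReal.sum_le_tsum F))
      by_cases hj0 : 0 < y j / y 0
      · simp only [h1 j hj hj0, if_true]; exact le_rfl
      · rw [ENNReal.ofReal_of_nonpos (not_lt.1 hj0)]; exact bot_le
    · refine h2.trans (le_of_eq ?_)
      congr 1
      field_simp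
  have hFatou : clusterConst P' ζ α ≤
      liminf (fun k => ∫⁻ ω, w k (fun j => ζ j ω) ^ α ∂P') atTop := by
    refine le_trans (lintegral_mono fun ω => ?_) (lintegral_liminf_le fun k =>
      ((measurable_truncAngularSum _ _).comp h.measurable_path').pow_const α)
    have := (ENNReal.monotone_rpow_of_nonneg h.pos.le).map_liminf_of_continuousAt
      (F := atTop) (fun k => w k fun j => ζ j ω) (ENNReal.continuous_rpow_const.continuousAt)
    refine le_trans (ENNReal.rpow_le_rpow (hpt _) h.pos.le) (le_of_eq this)
  obtain ⟨k, hk⟩ := (eventually_lt_of_lt_liminf (hb.trans_le hFatou)).exists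
  refine ⟨((k : ℝ) + 1) ^ 2, by positivity, hk.trans_le ?_⟩
  refine h.lintegral_truncAngularSum_le (by positivity) ?_
  rw [div_le_one (by positivity)]
  linarith [(Nat.cast_nonneg k : (0 : ℝ) ≤ k)]

end TailPair

/-! ### Window events and their limits -/

/-- Closed window event: no exceedance of `1` at times `-k, …, -1`, and a large sum of terms of
size at least `1` at times `0, …, k`. -/
def closedWindow (k : ℕ) (c : ℝ) : Set (ℤ → ℝ) :=
  {y | (∀ j ∈ Finset.Ico (-k : ℤ) 0, y j ≤ 1) ∧
    c ≤ ∑ j ∈ Finset.Icc (0 : ℤ) k, if 1 ≤ y j then y j else 0}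

/-- The open analogue of `closedWindow`. -/
def openWindow (k : ℕ) (c : ℝ) : Set (ℤ → ℝ) :=
  {y | (∀ j ∈ Finset.Ico (-k : ℤ) 0, y j < 1) ∧
    c < ∑ j ∈ Finset.Icc (0 : ℤ) k, if 1 < y j then y j else 0}

/-- At its upward jump the function takes the upper value, whereas the strict version takes the
lower one. This makes the two window events closed and open respectively, as the portmanteau bounds
require. -/
lemma upperSemicontinuous_ite : UpperSemicontinuous fun x : ℝ => if 1 ≤ x then x else 0 := by
  intro x b hb
  by_cases hx : 1 ≤ x
  · simp only [hx, if_true] at hb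
    filter_upwards [gt_mem_nhds hb] with y hy
    split_ifs
    · exact hy
    · linarith
  · simp only [hx, if_false] at hb
    filter_upwards [gt_mem_nhds (not_le.1 hx)] with y hy
    simpa [not_le.2 hy] using hb

lemma lowerSemicontinuous_ite : LowerSemicontinuous fun x : ℝ => if 1 < x then x else 0 := by
  intro x b hb
  by_cases hx : 1 < x
  · simp only [hx, if_true] at hb
    filter_upwards [lt_mem_nhds hb, lt_mem_nhds hx] with y hy hy1
    simpa [hy1] using hy
  · simp only [hx, if_false] at hb
    refine Eventually.of_forall fun y => ?_
    simp only
    split_ifs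
    · linarith
    · exact hb

lemma isClosed_closedWindow (k : ℕ) (c : ℝ) : IsClosed (closedWindow k c) := by
  refine IsClosed.inter ?_ ?_
  · have : {y : ℤ → ℝ | ∀ j ∈ Finset.Ico (-k : ℤ) 0, y j ≤ 1} =
        ⋂ j ∈ Finset.Ico (-k : ℤ) 0, {y | y j ≤ 1} := by ext y; simp
    exact (congrArg IsClosed this).mpr
      (isClosed_biInter fun j _ => isClosed_le (continuous_apply j) continuous_const)
  · have : UpperSemicontinuous fun y : ℤ → ℝ =>
        ∑ j ∈ Finset.Icc (0 : ℤ) k, if 1 ≤ y j then y j else 0 :=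
      upperSemicontinuous_sum fun j _ => upperSemicontinuous_ite.comp (continuous_apply j)
    exact this.isClosed_preimage c

lemma isOpen_openWindow (k : ℕ) (c : ℝ) : IsOpen (openWindow k c) := by
  refine IsOpen.inter ?_ ?_
  · have : {y : ℤ → ℝ | ∀ j ∈ Finset.Ico (-k : ℤ) 0, y j < 1} =
        ⋂ j ∈ Finset.Ico (-k : ℤ) 0, {y | y j < 1} := by ext y; simp
    exact (congrArg IsOpen this).mpr
      (isOpen_biInter_finset fun j _ => isOpen_lt (continuous_apply j) continuous_const)
  · have : LowerSemicontinuous fun y : ℤ → ℝ =>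
        ∑ j ∈ Finset.Icc (0 : ℤ) k, if 1 < y j then y j else 0 :=
      lowerSemicontinuous_sum fun j _ => lowerSemicontinuous_ite.comp (continuous_apply j)
    exact this.isOpen_preimage c

lemma dependsOnCoords_closedWindow (k : ℕ) (c : ℝ) :
    DependsOnCoords (closedWindow k c) (Finset.Icc (-k : ℤ) k) := by
  rintro y y' hy ⟨h1, h2⟩
  refine ⟨fun j hj => ?_, h2.trans (le_of_eq (Finset.sum_congr rfl fun j hj => ?_))⟩
  · rw [← hy j (by rw [Finset.mem_Ico] at hj; rw [Finset.mem_Icc]; omega)]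
    exact h1 j hj
  · rw [← hy j (by rw [Finset.mem_Icc] at hj ⊢; omega)]

lemma dependsOnCoords_openWindow (k : ℕ) (c : ℝ) :
    DependsOnCoords (openWindow k c) (Finset.Icc (-k : ℤ) k) := by
  rintro y y' hy ⟨h1, h2⟩
  refine ⟨fun j hj => ?_, h2.trans_eq (Finset.sum_congr rfl fun j hj => ?_)⟩
  · rw [← hy j (by rw [Finset.mem_Ico] at hj; rw [Finset.mem_Icc]; omega)]
    exact h1 j hj
  · rw [← hy j (by rw [Finset.mem_Icc] at hj ⊢; omega)]

namespace TailPair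

/-- Measurability of the total sum of the terms satisfying a condition. -/
lemma measurable_tsum_ite {p : ℝ → Prop} [DecidablePred p] (hp : MeasurableSet {x | p x}) :
    Measurable fun y : ℤ → ℝ => ∑' j : ℤ, ENNReal.ofReal (if p (y j) then y j else 0) :=
  Measurable.tsum fun j => ENNReal.measurable_ofReal.comp
    ((Measurable.ite hp measurable_id measurable_const).comp (measurable_pi_apply j))

lemma tsum_shift_eq (g : ℝ → ℝ≥0∞) (y : ℤ → ℝ) (a : ℤ) :
    ∑' j : ℤ, g (y (j - a)) = ∑' j : ℤ, g (y j) :=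
  (Equiv.subRight a).tsum_eq fun j => g (y j)

/-- Replacing the window sum by the full sum enlarges the event and makes it decreasing in `k`; in
the limit no exceedance precedes `0`, and the anchor can be moved to the first maximum. -/
lemma exists_bound_closedWindow (h : TailPair P ξ P' ζ α)
    (hv : ∀ᵐ ω ∂P', Vanishes fun j => ζ j ω) {c : ℝ} (hc : 0 < c) :
    ∃ (f : ℕ → ℝ≥0∞) (l : ℝ≥0∞), Tendsto f atTop (𝓝 l) ∧
      l ≤ clusterConst P' ζ α / ENNReal.ofReal c ^ α ∧
      ∀ k, P' {ω | (fun j => ζ j ω) ∈ closedWindow k c} ≤ f k := by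
  have hp := h.measurable_path'
  let H : Set (ℤ → ℝ) :=
    {y | ENNReal.ofReal c ≤ ∑' j : ℤ, ENNReal.ofReal (if 1 ≤ y j then y j else 0)}
  have hH : MeasurableSet H :=
    measurableSet_le measurable_const (measurable_tsum_ite measurableSet_Ici)
  have hinv : ∀ (y : ℤ → ℝ) (a : ℤ), (fun j => y (j - a)) ∈ H ↔ y ∈ H := fun y a => by
    simp only [H, Set.mem_ofPred_eq]
    rw [tsum_shift_eq (fun x => ENNReal.ofReal (if 1 ≤ x then x else 0))]
  let B : ℕ → Set Ω' := fun k =>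
    {ω | (fun j => ζ j ω) ∈ H ∧ ∀ j ∈ Finset.Ico (-k : ℤ) 0, ζ j ω ≤ 1}
  have hB : ∀ k, MeasurableSet (B k) := by
    intro k
    refine (hp hH).inter ?_
    have : {ω | ∀ j ∈ Finset.Ico (-k : ℤ) 0, ζ j ω ≤ 1} =
        ⋂ j ∈ Finset.Ico (-k : ℤ) 0, {ω | ζ j ω ≤ 1} := by ext ω; simp
    exact (congrArg MeasurableSet this).mpr (Finset.measurableSet_biInter _ fun j _ =>
      measurableSet_le (h.meas' j) measurable_const)
  have hanti : Antitone B := fun k l hkl ω hω => ⟨hω.1, fun j hj => hω.2 j (by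
    rw [Finset.mem_Ico] at hj ⊢; omega)⟩
  have hlim := tendsto_measure_iInter_atTop (μ := P') (fun k => (hB k).nullMeasurableSet) hanti
    ⟨0, measure_ne_top _ _⟩
  refine ⟨_, _, hlim, ?_, fun k => measure_mono ?_⟩
  · have e : ⋂ k, B k = {ω | (fun j => ζ j ω) ∈ H ∧ ∀ j < 0, ζ j ω ≤ 1} := by
      ext ω
      simp only [Set.mem_iInter]
      refine ⟨fun hω => ⟨(hω 0).1, fun j hj => (hω j.natAbs).2 j ?_⟩,
        fun hω k => ⟨hω.1, fun j hj => hω.2 j (Finset.mem_Ico.1 hj).2⟩⟩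
      rw [Finset.mem_Ico]; omega
    rw [e, h.measure_anchor_eq hv hH hinv]
    refine le_trans (measure_mono ?_) (h.measure_sum_ge_le hc)
    exact fun ω hω => ⟨hω.2, hω.1⟩
  · rintro ω ⟨h1, h2⟩
    refine ⟨?_, h1⟩
    refine (ENNReal.ofReal_le_ofReal h2).trans ?_
    rw [ENNReal.ofReal_sum_of_nonneg]
    · exact ENNReal.sum_le_tsum _
    · intro j _
      split_ifs
      · exact h.nonneg' j ω
      · exact le_rfl

/-- Imposing the no-exceedance condition on the whole past shrinks the event and makes it increasing
in `k`. Absence of atoms at `1` reconciles the strict bound on the past with the non-strict one used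
for anchoring. -/
lemma exists_bound_openWindow (h : TailPair P ξ P' ζ α)
    (hv : ∀ᵐ ω ∂P', Vanishes fun j => ζ j ω) {c : ℝ} (hc : 0 < c) :
    ∃ (f : ℕ → ℝ≥0∞), Tendsto f atTop (𝓝 (P' {ω | IsFirstMax (fun j => ζ j ω) 0 ∧
        ENNReal.ofReal c < ∑' j : ℤ, ENNReal.ofReal (if 1 < ζ j ω then ζ j ω else 0)})) ∧
      ∀ k, f k ≤ P' {ω | (fun j => ζ j ω) ∈ openWindow k c} := by
  let H : Set (ℤ → ℝ) :=
    {y | ENNReal.ofReal c < ∑' j : ℤ, ENNReal.ofReal (if 1 < y j then y j else 0)}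
  have hH : MeasurableSet H :=
    measurableSet_lt measurable_const (measurable_tsum_ite measurableSet_Ioi)
  have hinv : ∀ (y : ℤ → ℝ) (a : ℤ), (fun j => y (j - a)) ∈ H ↔ y ∈ H := fun y a => by
    simp only [H, Set.mem_ofPred_eq]
    rw [tsum_shift_eq (fun x => ENNReal.ofReal (if 1 < x then x else 0))]
  let A : Set Ω' := {ω | ∀ j < 0, ζ j ω < 1}
  let B : ℕ → Set Ω' := fun k =>
    A ∩ {ω | c < ∑ j ∈ Finset.Icc (0 : ℤ) k, if 1 < ζ j ω then ζ j ω else 0}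
  have hpos : ∀ j ω, 0 ≤ if 1 < ζ j ω then ζ j ω else 0 := fun j ω => by
    split_ifs
    · exact h.nonneg' j ω
    · exact le_rfl
  have hmono : Monotone B := by
    rintro k l hkl ω ⟨h1, h2⟩
    refine ⟨h1, lt_of_lt_of_le h2 (Finset.sum_le_sum_of_subset_of_nonneg ?_ fun j _ _ => hpos j ω)⟩
    exact Finset.Icc_subset_Icc le_rfl (by exact_mod_cast hkl)
  have hlim := tendsto_measure_iUnion_atTop (μ := P') hmono
  refine ⟨fun k => P' (B k), ?_, fun k => measure_mono ?_⟩
  · have e1 : P' {ω | IsFirstMax (fun j => ζ j ω) 0 ∧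
        ENNReal.ofReal c < ∑' j : ℤ, ENNReal.ofReal (if 1 < ζ j ω then ζ j ω else 0)} =
        P' {ω | (fun j => ζ j ω) ∈ H ∧ ∀ j < 0, ζ j ω ≤ 1} := by
      rw [h.measure_anchor_eq hv hH hinv]
      congr 1; ext ω; exact and_comm
    have e2 : P' {ω | (fun j => ζ j ω) ∈ H ∧ ∀ j < 0, ζ j ω ≤ 1} = P' (⋃ k, B k) := by
      refine measure_congr ?_
      have hne : ∀ᵐ ω ∂P', ∀ j, ζ j ω ≠ 1 := ae_all_iff.2 fun j => by
        rw [ae_iff]; simpa using h.measure_eq_zero j 1 one_ne_zero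
      filter_upwards [hne] with ω hω
      refine propext ⟨?_, ?_⟩
      · rintro ⟨h1, h2⟩
        obtain ⟨F, hF⟩ := ((ENNReal.summable.hasSum.eventually (lt_mem_nhds h1))).exists
        rw [← ENNReal.ofReal_sum_of_nonneg (fun j _ => hpos j ω),
          ENNReal.ofReal_lt_ofReal_iff_of_nonneg hc.le] at hF
        -- The sum of the absolute values bounds every index of `F`, so the window reaches all its
        -- nonnegative times; negative times contribute nothing.
        refine Set.mem_iUnion.2 ⟨∑ j ∈ F, j.natAbs,
          fun j hj => lt_of_le_of_ne (h2 j hj) (hω j), hF.trans_le ?_⟩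
        rw [← Finset.sum_filter_of_ne (p := fun j => j ∈ Finset.Icc (0 : ℤ) (∑ j ∈ F, j.natAbs : ℕ))]
        · exact Finset.sum_le_sum_of_subset_of_nonneg
            (fun j hj => (Finset.mem_filter.1 hj).2) fun j _ _ => hpos j ω
        · intro j hj hj0
          have h3 : 0 ≤ j := by
            by_contra hneg
            exact hj0 (if_neg (not_lt.2 (h2 j (not_le.1 hneg))))
          have h4 : j.natAbs ≤ ∑ j ∈ F, j.natAbs :=
            Finset.single_le_sum (f := fun j : ℤ => j.natAbs) (fun _ _ => Nat.zero_le _) hj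
          rw [Finset.mem_Icc]; omega
      · intro h1
        obtain ⟨k, h2, h3⟩ := Set.mem_iUnion.1 h1
        refine ⟨?_, fun j hj => (h2 j hj).le⟩
        have h4 := (ENNReal.ofReal_lt_ofReal_iff_of_nonneg hc.le).2 h3
        rw [ENNReal.ofReal_sum_of_nonneg (fun j _ => hpos j ω)] at h4
        exact h4.trans_le (ENNReal.sum_le_tsum _)
    rw [e1, e2]
    exact hlim
  · rintro ω ⟨h1, h2⟩
    exact ⟨fun j hj => h1 j (Finset.mem_Ico.1 hj).2, h2⟩

end TailPair

lemma sum_Icc_shift (g : ℤ → ℝ) (i k : ℤ) :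
    ∑ j ∈ Finset.Icc 0 k, g (j + i) = ∑ j ∈ Finset.Icc i (i + k), g j := by
  refine Finset.sum_bij (fun j _ => j + i) ?_ ?_ ?_ ?_
  · intro j hj; rw [Finset.mem_Icc] at hj ⊢; omega
  · intro a _ b _ hab; simpa using hab
  · intro j hj; rw [Finset.mem_Icc] at hj
    exact ⟨j - i, by rw [Finset.mem_Icc]; omega, by simp⟩
  · intro j _; rfl

/-! ### Locating the cluster inside a block -/

/-- A sequence exceeding level `v` at time `0` and again at a time at distance in `[k, r]`. -/
def farExceedance (k r : ℕ) (v : ℝ) : Set (ℤ → ℝ) :=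
  {y | v < y 0 ∧ ∃ j : ℤ, (k : ℤ) ≤ |j| ∧ |j| ≤ (r : ℤ) ∧ v < y j}

/-- `closedWindow` at level `v`. -/
def closedWindowAt (k : ℕ) (v t : ℝ) : Set (ℤ → ℝ) :=
  {y | v < y 0 ∧ (∀ j ∈ Finset.Ico (-k : ℤ) 0, y j ≤ v) ∧
    t ≤ ∑ j ∈ Finset.Icc (0 : ℤ) k, if v ≤ y j then y j else 0}

/-- `openWindow` at level `v`. -/
def openWindowAt (k : ℕ) (v t : ℝ) : Set (ℤ → ℝ) :=
  {y | v < y 0 ∧ (∀ j ∈ Finset.Ico (-k : ℤ) 0, y j < v) ∧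
    t < ∑ j ∈ Finset.Icc (0 : ℤ) k, if v < y j then y j else 0}

lemma measurableSet_farExceedance (k r : ℕ) (v : ℝ) : MeasurableSet (farExceedance k r v) := by
  refine (measurableSet_lt measurable_const (measurable_pi_apply 0)).inter ?_
  have : {y : ℤ → ℝ | ∃ j : ℤ, (k : ℤ) ≤ |j| ∧ |j| ≤ (r : ℤ) ∧ v < y j} =
      ⋃ j : ℤ, ⋃ _ : (k : ℤ) ≤ |j| ∧ |j| ≤ (r : ℤ), {y | v < y j} := by
    ext y; simp [and_assoc]
  exact (congrArg MeasurableSet this).mpr (.iUnion fun j => .iUnion fun _ =>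
    measurableSet_lt measurable_const (measurable_pi_apply j))

lemma measurableSet_closedWindowAt (k : ℕ) (v t : ℝ) : MeasurableSet (closedWindowAt k v t) := by
  refine (measurableSet_lt measurable_const (measurable_pi_apply 0)).inter (MeasurableSet.inter ?_ ?_)
  · have : {y : ℤ → ℝ | ∀ j ∈ Finset.Ico (-k : ℤ) 0, y j ≤ v} =
        ⋂ j ∈ Finset.Ico (-k : ℤ) 0, {y | y j ≤ v} := by ext y; simp
    exact (congrArg MeasurableSet this).mpr (Finset.measurableSet_biInter _ fun j _ =>
      measurableSet_le (measurable_pi_apply j) measurable_const)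
  · have : Measurable fun y : ℤ → ℝ => ∑ j ∈ Finset.Icc (0 : ℤ) k, if v ≤ y j then y j else 0 :=
      Finset.measurable_sum _ fun j _ =>
        Measurable.ite (measurableSet_le measurable_const (measurable_pi_apply j))
          (measurable_pi_apply j) measurable_const
    exact measurableSet_le measurable_const this

lemma measurableSet_openWindowAt (k : ℕ) (v t : ℝ) : MeasurableSet (openWindowAt k v t) := by
  refine (measurableSet_lt measurable_const (measurable_pi_apply 0)).inter (MeasurableSet.inter ?_ ?_)
  · have : {y : ℤ → ℝ | ∀ j ∈ Finset.Ico (-k : ℤ) 0, y j < v} =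
        ⋂ j ∈ Finset.Ico (-k : ℤ) 0, {y | y j < v} := by ext y; simp
    exact (congrArg MeasurableSet this).mpr (Finset.measurableSet_biInter _ fun j _ =>
      measurableSet_lt (measurable_pi_apply j) measurable_const)
  · have : Measurable fun y : ℤ → ℝ => ∑ j ∈ Finset.Icc (0 : ℤ) k, if v < y j then y j else 0 :=
      Finset.measurable_sum _ fun j _ =>
        Measurable.ite (measurableSet_lt measurable_const (measurable_pi_apply j))
          (measurable_pi_apply j) measurable_const
    exact measurableSet_lt measurable_const this

/-- Localisation of a large sum of exceedances around the first exceedance. -/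
lemma exists_mem_of_le_sum {y : ℤ → ℝ} (hy : ∀ j, 0 ≤ y j) (k r : ℕ) {v t : ℝ} (ht : 0 < t)
    (hS : t ≤ ∑ j ∈ Finset.Icc (1 : ℤ) r, if v < y j then y j else 0) :
    (∃ i ∈ Finset.Icc (1 : ℤ) k, v < y i) ∨
      ∃ i ∈ Finset.Icc (1 : ℤ) r, (fun j => y (j + i)) ∈ farExceedance k r v ∪ closedWindowAt k v t := by
  have hne : ((Finset.Icc (1 : ℤ) r).filter fun j => v < y j).Nonempty := by
    by_contra hemp
    rw [← Finset.sum_filter, Finset.not_nonempty_iff_eq_empty.1 hemp, Finset.sum_empty] at hS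
    exact absurd hS (not_le.2 ht)
  obtain ⟨i, hi, hmin⟩ := Finset.exists_min_image _ id hne
  rw [Finset.mem_filter, Finset.mem_Icc] at hi
  have hmin' : ∀ j, 1 ≤ j → j < i → y j ≤ v := by
    intro j h1 h2
    by_contra hj
    have := hmin j (by rw [Finset.mem_filter, Finset.mem_Icc]; exact ⟨by omega, not_le.1 hj⟩)
    simp only [id] at this
    omega
  -- For `i ≤ k` the backward window leaves the block, where nothing is known; these `k` times are
  -- set aside as a boundary term.
  by_cases hik : i ≤ k
  · exact Or.inl ⟨i, Finset.mem_Icc.2 ⟨hi.1.1, hik⟩, hi.2⟩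
  refine Or.inr ⟨i, Finset.mem_Icc.2 hi.1, ?_⟩
  -- Without an exceedance at distance at least `k`, all exceedances of the block lie in the forward
  -- window of `i`, which then carries the whole sum.
  by_cases hfar : ∃ j ∈ Finset.Icc (1 : ℤ) r, (k : ℤ) ≤ |j - i| ∧ v < y j
  · obtain ⟨j, hj, h1, h2⟩ := hfar
    rw [Finset.mem_Icc] at hj
    refine Or.inl ⟨by simpa using hi.2, j - i, h1, ?_, by simpa using h2⟩
    rw [abs_le]; omega
  · push Not at hfar
    refine Or.inr ⟨by simpa using hi.2, fun j hj => ?_, ?_⟩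
    · rw [Finset.mem_Ico] at hj
      exact hmin' _ (by omega) (by omega)
    · rw [sum_Icc_shift (fun j => if v ≤ y j then y j else 0) i k]
      refine hS.trans ?_
      rw [← Finset.sum_filter]
      calc ∑ j ∈ (Finset.Icc (1 : ℤ) r).filter (fun j => v < y j), y j
          = ∑ j ∈ (Finset.Icc (1 : ℤ) r).filter (fun j => v < y j), if v ≤ y j then y j else 0 :=
            Finset.sum_congr rfl fun j hj => by
              rw [if_pos (Finset.mem_filter.1 hj).2.le]
        _ ≤ _ := by
            refine Finset.sum_le_sum_of_subset_of_nonneg (fun j hj => ?_) fun j _ _ => ?_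
            · rw [Finset.mem_filter] at hj
              have h1 : i ≤ j := hmin j (Finset.mem_filter.2 hj)
              have h2 : |j - i| < k := by
                by_contra hcon
                exact absurd hj.2 (not_lt.2 (hfar j hj.1 (not_lt.1 hcon)))
              rw [abs_lt] at h2
              rw [Finset.mem_Icc]; omega
            · split_ifs
              · exact hy j
              · exact le_rfl

namespace TailPair

lemma measure_le_sum_le (h : TailPair P ξ P' ζ α) (k r : ℕ) {v t : ℝ} (ht : 0 < t) :
    P {ω | t ≤ ∑ j ∈ Finset.Icc (1 : ℤ) r, if v < ξ j ω then ξ j ω else 0} ≤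
      k * P {ω | v < ξ 0 ω} + r * (P {ω | (fun j => ξ j ω) ∈ farExceedance k r v} +
        P {ω | (fun j => ξ j ω) ∈ closedWindowAt k v t}) := by
  have hcard : ∀ n : ℕ, (Finset.Icc (1 : ℤ) n).card = n := fun n => by simp
  calc _ ≤ P ((⋃ i ∈ Finset.Icc (1 : ℤ) k, {ω | v < ξ i ω}) ∪ ⋃ i ∈ Finset.Icc (1 : ℤ) r,
        ({ω | (fun j => ξ (j + i) ω) ∈ farExceedance k r v} ∪
          {ω | (fun j => ξ (j + i) ω) ∈ closedWindowAt k v t})) := by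
        refine measure_mono fun ω hω => ?_
        rcases exists_mem_of_le_sum (fun j => h.nonneg j ω) k r ht hω with ⟨i, hi, h1⟩ | ⟨i, hi, h1⟩
        · exact Or.inl (Set.mem_biUnion hi h1)
        · exact Or.inr (Set.mem_biUnion hi h1)
    _ ≤ (∑ i ∈ Finset.Icc (1 : ℤ) k, P {ω | v < ξ i ω}) + ∑ i ∈ Finset.Icc (1 : ℤ) r,
        (P {ω | (fun j => ξ (j + i) ω) ∈ farExceedance k r v} +
          P {ω | (fun j => ξ (j + i) ω) ∈ closedWindowAt k v t}) := by
        refine (measure_union_le _ _).trans (add_le_add (measure_biUnion_finset_le _ _)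
          ((measure_biUnion_finset_le _ _).trans (Finset.sum_le_sum fun i _ => measure_union_le _ _)))
    _ = _ := by
        have e1 : ∀ i : ℤ, P {ω | v < ξ i ω} = P {ω | v < ξ 0 ω} := fun i => by
          have := h.measure_shift i (A := {y | v < y 0})
            (measurableSet_lt measurable_const (measurable_pi_apply 0))
          simp only [Set.mem_ofPred_eq, zero_add] at this
          exact this.symm
        simp only [e1, ← h.measure_shift _ (measurableSet_farExceedance k r v),
          ← h.measure_shift _ (measurableSet_closedWindowAt k v t), Finset.sum_const, hcard,
          nsmul_eq_mul]

/-- The times from `k + 1` to `r - k` have their whole window inside the block. Once far exceedances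
are removed, the window events at these times are disjoint, so their probabilities add up inside the
block event. -/
lemma mul_measure_le (h : TailPair P ξ P' ζ α) (k r : ℕ) (v t : ℝ) :
    ((r - 2 * k : ℕ) : ℝ≥0∞) * P {ω | (fun j => ξ j ω) ∈ openWindowAt k v t} ≤
      P {ω | t < ∑ j ∈ Finset.Icc (1 : ℤ) r, if v < ξ j ω then ξ j ω else 0} +
        r * P {ω | (fun j => ξ j ω) ∈ farExceedance k r v} := by
  let I : Finset ℤ := Finset.Icc (k + 1 : ℤ) (r - k)
  have hI : I.card = r - 2 * k := by simp [I]; omega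
  have hps : ∀ i : ℤ, Measurable fun ω (j : ℤ) => ξ (j + i) ω := fun i =>
    measurable_pi_lambda _ fun j => h.meas _
  let G : ℤ → Set Ω := fun i => {ω | (fun j => ξ (j + i) ω) ∈ openWindowAt k v t}
  let B : ℤ → Set Ω := fun i => {ω | (fun j => ξ (j + i) ω) ∈ farExceedance k r v}
  have hG : ∀ i, MeasurableSet (G i) := fun i => hps i (measurableSet_openWindowAt k v t)
  have hB : ∀ i, MeasurableSet (B i) := fun i => hps i (measurableSet_farExceedance k r v)
  -- The window excludes exceedances during the `k` times before `i`, and the absence of far ones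
  -- excludes the rest: `i` is the first exceedance in the block.
  have hfirst : ∀ i ∈ I, ∀ ω ∈ G i \ B i, v < ξ i ω ∧ ∀ j, 1 ≤ j → j < i → ξ j ω ≤ v := by
    rintro i hi ω ⟨⟨h1, h2, -⟩, h3⟩
    rw [Finset.mem_Icc] at hi
    refine ⟨by simpa using h1, fun j hj1 hj2 => ?_⟩
    by_cases hj : i - k ≤ j
    · have := h2 (j - i) (by rw [Finset.mem_Ico]; omega)
      simpa using this.le
    · by_contra hcon
      refine h3 ⟨h1, j - i, ?_, ?_, by simpa using hcon⟩
      · rw [abs_of_neg (by omega)]; omega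
      · rw [abs_le]; omega
  have hdisj : (I : Set ℤ).PairwiseDisjoint fun i => G i \ B i := by
    have aux : ∀ i ∈ I, ∀ i' ∈ I, i < i' → Disjoint (G i \ B i) (G i' \ B i') := by
      intro i hi i' hi' hlt
      refine Set.disjoint_left.2 fun ω h1 h2 => ?_
      rw [Finset.mem_Icc] at hi
      exact absurd (hfirst i (Finset.mem_Icc.2 hi) ω h1).1
        (not_lt.2 ((hfirst i' hi' ω h2).2 i (by omega) hlt))
    intro i hi i' hi' hne
    rcases lt_or_gt_of_ne hne with hlt | hlt
    · exact aux i hi i' hi' hlt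
    · exact (aux i' hi' i hi hlt).symm
  have hsub : (⋃ i ∈ I, G i \ B i) ⊆
      {ω | t < ∑ j ∈ Finset.Icc (1 : ℤ) r, if v < ξ j ω then ξ j ω else 0} := by
    intro ω hω
    obtain ⟨i, hi, ⟨-, -, h3⟩, -⟩ := Set.mem_iUnion₂.1 hω
    rw [sum_Icc_shift (fun j => if v < ξ j ω then ξ j ω else 0) i k] at h3
    rw [Finset.mem_Icc] at hi
    refine h3.trans_le (Finset.sum_le_sum_of_subset_of_nonneg (fun j hj => ?_) fun j _ _ => ?_)
    · rw [Finset.mem_Icc] at hj ⊢; omega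
    · split_ifs
      · exact h.nonneg j ω
      · exact le_rfl
  have hle : ((r - 2 * k : ℕ) : ℝ≥0∞) ≤ r := by exact_mod_cast Nat.sub_le _ _
  calc ((r - 2 * k : ℕ) : ℝ≥0∞) * P {ω | (fun j => ξ j ω) ∈ openWindowAt k v t}
      = ∑ i ∈ I, P (G i) := by
        simp only [G, ← h.measure_shift _ (measurableSet_openWindowAt k v t), Finset.sum_const, hI,
          nsmul_eq_mul]
    _ ≤ ∑ i ∈ I, (P (G i \ B i) + P (B i)) := Finset.sum_le_sum fun i _ => by
        refine (measure_mono (t := (G i \ B i) ∪ B i) ?_).trans (measure_union_le _ _)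
        rw [Set.sdiff_union_self]; exact Set.subset_union_left
    _ = P (⋃ i ∈ I, G i \ B i) +
        ((r - 2 * k : ℕ) : ℝ≥0∞) * P {ω | (fun j => ξ j ω) ∈ farExceedance k r v} := by
        rw [Finset.sum_add_distrib, measure_biUnion_finset hdisj fun i _ => (hG i).diff (hB i)]
        simp only [B, ← h.measure_shift _ (measurableSet_farExceedance k r v), Finset.sum_const, hI,
          nsmul_eq_mul]
    _ ≤ _ := add_le_add (measure_mono hsub) (by gcongr)

end TailPair

/-! ### Asymptotics of truncated block sums -/

lemma ennreal_limsup_add_le (a b : ℕ → ℝ≥0∞) :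
    limsup (fun n => a n + b n) atTop ≤ limsup a atTop + limsup b atTop := by
  refine ENNReal.le_of_forall_pos_le_add fun ε hε hlt => ?_
  have hε2 : ((ε : ℝ≥0∞) / 2) ≠ 0 := by simpa using hε.ne'
  have ha : ∀ᶠ n in atTop, a n < limsup a atTop + (ε : ℝ≥0∞) / 2 :=
    eventually_lt_of_limsup_lt (ENNReal.lt_add_right (ENNReal.add_lt_top.1 hlt).1.ne hε2)
  have hb : ∀ᶠ n in atTop, b n < limsup b atTop + (ε : ℝ≥0∞) / 2 :=
    eventually_lt_of_limsup_lt (ENNReal.lt_add_right (ENNReal.add_lt_top.1 hlt).2.ne hε2)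
  refine limsup_le_of_le (by isBoundedDefault) ?_
  filter_upwards [ha, hb] with n h1 h2
  refine (add_le_add h1.le h2.le).trans (le_of_eq ?_)
  rw [add_add_add_comm, ENNReal.add_halves]

lemma ennreal_liminf_add_le (a b : ℕ → ℝ≥0∞) :
    liminf (fun n => a n + b n) atTop ≤ liminf a atTop + limsup b atTop := by
  refine ENNReal.le_of_forall_pos_le_add fun ε hε hlt => ?_
  have hε2 : ((ε : ℝ≥0∞) / 2) ≠ 0 := by simpa using hε.ne'
  have ha : ∃ᶠ n in atTop, a n < liminf a atTop + (ε : ℝ≥0∞) / 2 :=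
    frequently_lt_of_liminf_lt (by isBoundedDefault)
      (ENNReal.lt_add_right (ENNReal.add_lt_top.1 hlt).1.ne hε2)
  have hb : ∀ᶠ n in atTop, b n < limsup b atTop + (ε : ℝ≥0∞) / 2 :=
    eventually_lt_of_limsup_lt (ENNReal.lt_add_right (ENNReal.add_lt_top.1 hlt).2.ne hε2)
  refine liminf_le_of_frequently_le ((ha.and_eventually hb).mono fun n hn => ?_)
  refine (add_le_add hn.1.le hn.2.le).trans (le_of_eq ?_)
  rw [add_add_add_comm, ENNReal.add_halves]

/-- In use, `A` is the boundary term, `ρ` the tail ratio between levels `u n * ε` and `u n`, `d` the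
far exceedances and `g` the window event. -/
lemma limsup_le_of_eventually_le {R A ρ d g : ℕ → ℝ≥0∞} {e : ℝ≥0∞} (he0 : e ≠ 0) (he : e ≠ ⊤)
    (hA : Tendsto A atTop (𝓝 0)) (hρ : Tendsto ρ atTop (𝓝 e))
    (h : ∀ᶠ n in atTop, R n ≤ A n + ρ n * (d n + g n)) :
    limsup R atTop ≤ e * (limsup d atTop + limsup g atTop) := by
  calc limsup R atTop ≤ limsup (fun n => A n + ρ n * (d n + g n)) atTop := limsup_le_limsup h
    _ ≤ limsup A atTop + limsup (fun n => ρ n * (d n + g n)) atTop := ennreal_limsup_add_le _ _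
    _ = limsup (ρ * fun n => d n + g n) atTop := by rw [hA.limsup_eq, zero_add]; rfl
    _ ≤ limsup ρ atTop * limsup (fun n => d n + g n) atTop :=
        ENNReal.limsup_mul_le' (Or.inl (hρ.limsup_eq ▸ he0)) (Or.inl (hρ.limsup_eq ▸ he))
    _ ≤ _ := by
        rw [hρ.limsup_eq]
        gcongr
        exact ennreal_limsup_add_le _ _

lemma le_liminf_of_eventually_le {R a ρ d g : ℕ → ℝ≥0∞} {e : ℝ≥0∞} (he0 : e ≠ 0) (he : e ≠ ⊤)
    (ha : Tendsto a atTop (𝓝 e)) (hρ : Tendsto ρ atTop (𝓝 e))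
    (h : ∀ᶠ n in atTop, a n * g n ≤ R n + ρ n * d n) :
    e * liminf g atTop ≤ liminf R atTop + e * limsup d atTop := by
  calc e * liminf g atTop = liminf a atTop * liminf g atTop := by rw [ha.liminf_eq]
    _ ≤ liminf (a * g) atTop := ENNReal.le_liminf_mul
    _ ≤ liminf (fun n => R n + ρ n * d n) atTop := liminf_le_liminf h
    _ ≤ liminf R atTop + limsup (ρ * d) atTop := ennreal_liminf_add_le _ _
    _ ≤ _ := by
        gcongr
        refine (ENNReal.limsup_mul_le' (Or.inl (hρ.limsup_eq ▸ he0))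
          (Or.inl (hρ.limsup_eq ▸ he))).trans ?_
        rw [hρ.limsup_eq]

namespace TailPair

lemma measure_inter_eq_mul_cond (h : TailPair P ξ P' ζ α) (v : ℝ) (B : Set Ω) :
    P ({ω | v < ξ 0 ω} ∩ B) = P {ω | v < ξ 0 ω} * P[B | {ω | v < ξ 0 ω}] := by
  rw [mul_comm, cond_mul_eq_inter (h.measurableSet_tail 0 v)]

lemma measure_farExceedance_eq (h : TailPair P ξ P' ζ α) (k r : ℕ) (v : ℝ) :
    P {ω | (fun j => ξ j ω) ∈ farExceedance k r v} = P {ω | v < ξ 0 ω} *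
      P[{ω | ∃ j : ℤ, (k : ℤ) ≤ |j| ∧ |j| ≤ (r : ℤ) ∧ v < ξ j ω} | {ω | v < ξ 0 ω}] := by
  rw [← h.measure_inter_eq_mul_cond]
  rfl

lemma measure_closedWindowAt_eq (h : TailPair P ξ P' ζ α) (k : ℕ) {v : ℝ} (hv : 0 < v) (t : ℝ) :
    P {ω | (fun j => ξ j ω) ∈ closedWindowAt k v t} = P {ω | v < ξ 0 ω} *
      P[{ω | (fun j => v⁻¹ * ξ j ω) ∈ closedWindow k (t / v)} | {ω | v < ξ 0 ω}] := by
  rw [← h.measure_inter_eq_mul_cond]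
  congr 1; ext ω
  have e1 : ∀ x : ℝ, v⁻¹ * x ≤ 1 ↔ x ≤ v := fun x => by
    rw [inv_mul_le_iff₀ hv, mul_one]
  have e2 : ∀ x : ℝ, 1 ≤ v⁻¹ * x ↔ v ≤ x := fun x => by
    rw [le_inv_mul_iff₀ hv, mul_one]
  have e3 : (∑ j ∈ Finset.Icc (0 : ℤ) k, if v ≤ ξ j ω then v⁻¹ * ξ j ω else 0) =
      v⁻¹ * ∑ j ∈ Finset.Icc (0 : ℤ) k, if v ≤ ξ j ω then ξ j ω else 0 := by
    rw [Finset.mul_sum]; refine Finset.sum_congr rfl fun j _ => ?_; split_ifs <;> simp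
  simp only [closedWindowAt, closedWindow, Set.mem_ofPred_eq, Set.mem_inter_iff, e1, e2, e3]
  rw [inv_mul_eq_div, div_le_div_iff_of_pos_right hv]

lemma measure_openWindowAt_eq (h : TailPair P ξ P' ζ α) (k : ℕ) {v : ℝ} (hv : 0 < v) (t : ℝ) :
    P {ω | (fun j => ξ j ω) ∈ openWindowAt k v t} = P {ω | v < ξ 0 ω} *
      P[{ω | (fun j => v⁻¹ * ξ j ω) ∈ openWindow k (t / v)} | {ω | v < ξ 0 ω}] := by
  rw [← h.measure_inter_eq_mul_cond]
  congr 1; ext ω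
  have e1 : ∀ x : ℝ, v⁻¹ * x < 1 ↔ x < v := fun x => by
    rw [inv_mul_lt_iff₀ hv, mul_one]
  have e2 : ∀ x : ℝ, 1 < v⁻¹ * x ↔ v < x := fun x => by
    rw [lt_inv_mul_iff₀ hv, mul_one]
  have e3 : (∑ j ∈ Finset.Icc (0 : ℤ) k, if v < ξ j ω then v⁻¹ * ξ j ω else 0) =
      v⁻¹ * ∑ j ∈ Finset.Icc (0 : ℤ) k, if v < ξ j ω then ξ j ω else 0 := by
    rw [Finset.mul_sum]; refine Finset.sum_congr rfl fun j _ => ?_; split_ifs <;> simp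
  simp only [openWindowAt, openWindow, Set.mem_ofPred_eq, Set.mem_inter_iff, e1, e2, e3]
  rw [inv_mul_eq_div, div_lt_div_iff_of_pos_right hv]

variable {r : ℕ → ℕ} {u : ℕ → ℝ}

lemma tendsto_tail_ratio (h : TailPair P ξ P' ζ α) (hu : Tendsto u atTop atTop) {ε : ℝ}
    (hε : 0 < ε) :
    Tendsto (fun n => P {ω | u n * ε < ξ 0 ω} / P {ω | u n < ξ 0 ω}) atTop
      (𝓝 (ENNReal.ofReal (ε ^ (-α)))) := by
  refine ((h.ratio ε hε).comp hu).congr fun n => ?_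
  simp only [Function.comp, mul_comm ε]

/-- Upper bound for the normalised probability of a large sum of exceedances. -/
lemma limsup_measure_le (h : TailPair P ξ P' ζ α) (hr : Tendsto r atTop atTop)
    (hu : Tendsto u atTop atTop) (hac : AntiCluster P ξ r u) {c ε : ℝ} (hc : 0 < c) (hε : 0 < ε)
    {f : ℕ → ℝ≥0∞} {l : ℝ≥0∞} (hf : Tendsto f atTop (𝓝 l))
    (hfk : ∀ k, P' {ω | (fun j => ζ j ω) ∈ closedWindow k (c / ε)} ≤ f k) :
    limsup (fun n => P {ω | c * u n ≤
        ∑ j ∈ Finset.Icc (1 : ℤ) (r n), if u n * ε < ξ j ω then ξ j ω else 0} /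
          ((r n : ℝ≥0∞) * P {ω | u n < ξ 0 ω})) atTop ≤ ENNReal.ofReal (ε ^ (-α)) * l := by
  set e := ENNReal.ofReal (ε ^ (-α)) with he
  have he0 : e ≠ 0 := by simpa [he] using Real.rpow_pos_of_pos hε (-α)
  have het : e ≠ ⊤ := ENNReal.ofReal_ne_top
  set d : ℕ → ℝ≥0∞ := fun k => limsup (fun n : ℕ =>
        P[{ω | ∃ j : ℤ, (k : ℤ) ≤ |j| ∧ |j| ≤ (r n : ℤ) ∧ u n * ε < ξ j ω} |
          {ω | u n * ε < ξ 0 ω}]) atTop with hd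
  have hd0 : Tendsto d atTop (𝓝 0) := hac ε ε hε hε
  have hρ := h.tendsto_tail_ratio hu hε
  have huε : Tendsto (fun n => u n * ε) atTop atTop := hu.atTop_mul_const hε
  have main : ∀ k : ℕ, limsup (fun n => P {ω | c * u n ≤
        ∑ j ∈ Finset.Icc (1 : ℤ) (r n), if u n * ε < ξ j ω then ξ j ω else 0} /
          ((r n : ℝ≥0∞) * P {ω | u n < ξ 0 ω})) atTop ≤ e * (d k + f k) := by
    intro k
    have hg : limsup (fun n => P[{ω | (fun j => (u n * ε)⁻¹ * ξ j ω) ∈ closedWindow k (c / ε)} |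
        {ω | u n * ε < ξ 0 ω}]) atTop ≤ f k := by
      refine le_trans ?_ ((h.limsup_measure_closed_le (isClosed_closedWindow k (c / ε))
        (dependsOnCoords_closedWindow k (c / ε))).trans (hfk k))
      exact limsup_le_limsup_of_le (f := map (fun n => u n * ε) atTop)
        (u := fun x : ℝ => P[{ω | (fun j => x⁻¹ * ξ j ω) ∈ closedWindow k (c / ε)} |
        {ω | x < ξ 0 ω}]) huε
    -- With `k` fixed, the `k` boundary times are negligible among the `r n` times of the block.
    have hA : Tendsto (fun n => ((k : ℝ≥0∞) / r n) *
        (P {ω | u n * ε < ξ 0 ω} / P {ω | u n < ξ 0 ω})) atTop (𝓝 0) := by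
      have h1 : Tendsto (fun n => (k : ℝ≥0∞) / r n) atTop (𝓝 0) := by
        have := ENNReal.Tendsto.const_div (a := (k : ℝ≥0∞)) (ENNReal.tendsto_nat_nhds_top.comp hr)
          (Or.inr (ENNReal.natCast_ne_top k))
        simpa using this
      have := ENNReal.Tendsto.mul h1 (Or.inr het) hρ (Or.inr ENNReal.zero_ne_top)
      simpa using this
    refine (limsup_le_of_eventually_le he0 het hA hρ ?_).trans (by gcongr)
    filter_upwards [hu.eventually_gt_atTop 0, hr.eventually_gt_atTop 0, hu.eventually h.tail_ne_zero]
      with n hun hrn hpn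
    have hv : 0 < u n * ε := by positivity
    have hb := h.measure_le_sum_le k (r n) (v := u n * ε) (t := c * u n) (by positivity)
    rw [h.measure_farExceedance_eq, h.measure_closedWindowAt_eq k hv,
      show c * u n / (u n * ε) = c / ε by field_simp] at hb
    refine (ENNReal.div_le_div_right hb _).trans (le_of_eq ?_)
    have hrn0 : (r n : ℝ≥0∞) ≠ 0 := by exact_mod_cast hrn.ne'
    have hrnt : (r n : ℝ≥0∞) ≠ ⊤ := ENNReal.natCast_ne_top _
    have hpt : P {ω | u n < ξ 0 ω} ≠ ⊤ := measure_ne_top _ _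
    rw [ENNReal.add_div, ENNReal.mul_div_mul_comm (Or.inl hrn0) (Or.inl hrnt), ← mul_add,
      ENNReal.mul_div_mul_left _ _ hrn0 hrnt]
    simp only [div_eq_mul_inv]
    ring
  have hlim : Tendsto (fun k => e * (d k + f k)) atTop (𝓝 (e * (0 + l))) :=
    ENNReal.Tendsto.const_mul (hd0.add hf) (Or.inr het)
  rw [zero_add] at hlim
  exact ge_of_tendsto' hlim main

/-- Lower bound for the normalised probability of a large sum of exceedances. -/
lemma le_liminf_measure (h : TailPair P ξ P' ζ α) (hr : Tendsto r atTop atTop)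
    (hu : Tendsto u atTop atTop) (hac : AntiCluster P ξ r u) {ε : ℝ} (hε : 0 < ε)
    {f : ℕ → ℝ≥0∞} {l : ℝ≥0∞} (hf : Tendsto f atTop (𝓝 l))
    (hfk : ∀ k, f k ≤ P' {ω | (fun j => ζ j ω) ∈ openWindow k (1 / ε)}) :
    ENNReal.ofReal (ε ^ (-α)) * l ≤ liminf (fun n => P {ω | u n <
        ∑ j ∈ Finset.Icc (1 : ℤ) (r n), if u n * ε < ξ j ω then ξ j ω else 0} /
          ((r n : ℝ≥0∞) * P {ω | u n < ξ 0 ω})) atTop := by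
  set e := ENNReal.ofReal (ε ^ (-α)) with he
  have he0 : e ≠ 0 := by simpa [he] using Real.rpow_pos_of_pos hε (-α)
  have het : e ≠ ⊤ := ENNReal.ofReal_ne_top
  set d : ℕ → ℝ≥0∞ := fun k => limsup (fun n : ℕ =>
        P[{ω | ∃ j : ℤ, (k : ℤ) ≤ |j| ∧ |j| ≤ (r n : ℤ) ∧ u n * ε < ξ j ω} |
          {ω | u n * ε < ξ 0 ω}]) atTop with hd
  have hd0 : Tendsto d atTop (𝓝 0) := hac ε ε hε hε
  have hρ := h.tendsto_tail_ratio hu hε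
  have huε : Tendsto (fun n => u n * ε) atTop atTop := hu.atTop_mul_const hε
  set L := liminf (fun n => P {ω | u n <
        ∑ j ∈ Finset.Icc (1 : ℤ) (r n), if u n * ε < ξ j ω then ξ j ω else 0} /
          ((r n : ℝ≥0∞) * P {ω | u n < ξ 0 ω})) atTop with hL
  have main : ∀ k : ℕ, e * f k ≤ L + e * d k := by
    intro k
    have hg : f k ≤ liminf (fun n => P[{ω | (fun j => (u n * ε)⁻¹ * ξ j ω) ∈ openWindow k (1 / ε)} |
        {ω | u n * ε < ξ 0 ω}]) atTop := by
      refine ((hfk k).trans (h.measure_open_le_liminf (isOpen_openWindow k (1 / ε))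
        (dependsOnCoords_openWindow k (1 / ε)))).trans ?_
      exact liminf_le_liminf_of_le (f := atTop) (g := map (fun n => u n * ε) atTop)
        (u := fun x : ℝ => P[{ω | (fun j => x⁻¹ * ξ j ω) ∈ openWindow k (1 / ε)} |
        {ω | x < ξ 0 ω}]) huε
    have ha : Tendsto (fun n => (((r n - 2 * k : ℕ) : ℝ≥0∞) / r n) *
        (P {ω | u n * ε < ξ 0 ω} / P {ω | u n < ξ 0 ω})) atTop (𝓝 e) := by
      -- Almost all times of the block have their window inside it.
      have h1 : Tendsto (fun n => ((r n - 2 * k : ℕ) : ℝ≥0∞) / r n) atTop (𝓝 1) := by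
        have h2 : Tendsto (fun n => (1 : ℝ≥0∞) - ((2 * k : ℕ) : ℝ≥0∞) / r n) atTop (𝓝 (1 - 0)) := by
          refine ENNReal.Tendsto.sub tendsto_const_nhds ?_ (Or.inl ENNReal.one_ne_top)
          have := ENNReal.Tendsto.const_div (a := ((2 * k : ℕ) : ℝ≥0∞))
            (ENNReal.tendsto_nat_nhds_top.comp hr) (Or.inr (ENNReal.natCast_ne_top _))
          simpa using this
        rw [tsub_zero] at h2
        refine h2.congr' ?_
        filter_upwards [hr.eventually_gt_atTop 0] with n hrn
        have hrn0 : (r n : ℝ≥0∞) ≠ 0 := by exact_mod_cast hrn.ne'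
        rw [ENNReal.natCast_sub, ENNReal.sub_div fun _ _ => hrn0,
          ENNReal.div_self hrn0 (ENNReal.natCast_ne_top _)]
      have := ENNReal.Tendsto.mul h1 (Or.inr het) hρ (Or.inr ENNReal.one_ne_top)
      simpa using this
    refine le_trans (by gcongr) (le_liminf_of_eventually_le he0 het ha hρ ?_)
    filter_upwards [hu.eventually_gt_atTop 0, hr.eventually_gt_atTop 0, hu.eventually h.tail_ne_zero]
      with n hun hrn hpn
    have hv : 0 < u n * ε := by positivity
    have hb := h.mul_measure_le k (r n) (u n * ε) (u n)
    rw [h.measure_farExceedance_eq, h.measure_openWindowAt_eq k hv,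
      show u n / (u n * ε) = 1 / ε by field_simp] at hb
    have hrn0 : (r n : ℝ≥0∞) ≠ 0 := by exact_mod_cast hrn.ne'
    have hrnt : (r n : ℝ≥0∞) ≠ ⊤ := ENNReal.natCast_ne_top _
    have hb2 := ENNReal.div_le_div_right hb ((r n : ℝ≥0∞) * P {ω | u n < ξ 0 ω})
    rw [ENNReal.add_div, ENNReal.mul_div_mul_comm (Or.inl hrn0) (Or.inl hrnt),
      ENNReal.mul_div_mul_left _ _ hrn0 hrnt] at hb2
    refine le_trans (le_of_eq ?_) (hb2.trans (le_of_eq ?_))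
    · simp only [div_eq_mul_inv]; ring
    · simp only [div_eq_mul_inv]; ring
  have hlim1 : Tendsto (fun k => e * f k) atTop (𝓝 (e * l)) :=
    ENNReal.Tendsto.const_mul hf (Or.inr het)
  have hlim2 : Tendsto (fun k => L + e * d k) atTop (𝓝 (L + e * 0)) :=
    tendsto_const_nhds.add (ENNReal.Tendsto.const_mul hd0 (Or.inr het))
  rw [mul_zero, add_zero] at hlim2
  exact le_of_tendsto_of_tendsto' hlim1 hlim2 main

end TailPair

/-! ### Small jumps and the limit theorem for nonnegative processes -/

/-- Asymptotic negligibility of small jumps for a real process. -/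
def SmallJumps (P : Measure Ω) (ξ : ℤ → Ω → ℝ) (r : ℕ → ℕ) (u : ℕ → ℝ) : Prop :=
  ∀ η : ℝ, 0 < η →
    Tendsto (fun ε : ℝ =>
      limsup (fun n : ℕ =>
        P {ω | η * u n < ∑ j ∈ Finset.Icc (1 : ℤ) (r n),
            {ω' | ξ j ω' ≤ ε * u n}.indicator (fun ω' => ξ j ω') ω} /
          ((r n : ℝ≥0∞) * P {ω | u n < ξ 0 ω})) atTop)
      (𝓝[>] 0) (𝓝 0)

namespace TailPair

variable {r : ℕ → ℕ} {u : ℕ → ℝ}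

/-- Discarding small terms only lowers the sum, so no control of them is needed. The truncation
level is `ε = 1 / c`, which turns `ε ^ (-α)` into the factor `c ^ α` of the Fatou bound. -/
lemma clusterConst_le_liminf (h : TailPair P ξ P' ζ α) (hr : Tendsto r atTop atTop)
    (hu : Tendsto u atTop atTop) (hac : AntiCluster P ξ r u) :
    clusterConst P' ζ α ≤ liminf (fun n => P {ω | u n < ∑ j ∈ Finset.Icc (1 : ℤ) (r n), ξ j ω} /
      ((r n : ℝ≥0∞) * P {ω | u n < ξ 0 ω})) atTop := by
  refine le_of_forall_lt_imp_le_of_dense fun b hb => ?_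
  obtain ⟨c, hc, hbc⟩ := h.exists_lt_of_lt_clusterConst hb
  obtain ⟨f, hf, hfk⟩ := h.exists_bound_openWindow (h.ae_vanishes hr hu hac) hc
  have h1 := h.le_liminf_measure hr hu hac (ε := 1 / c) (by positivity) hf (by simpa using hfk)
  rw [one_div, Real.inv_rpow hc.le, Real.rpow_neg hc.le, inv_inv,
    ← ENNReal.ofReal_rpow_of_pos hc] at h1
  refine hbc.le.trans (h1.trans (liminf_le_liminf (Eventually.of_forall fun n => ?_)))
  refine ENNReal.div_le_div_right (measure_mono fun ω hω => ?_) _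
  rw [Set.mem_ofPred_eq] at hω ⊢
  refine lt_of_lt_of_le hω (Finset.sum_le_sum fun j _ => ?_)
  split_ifs
  · exact le_rfl
  · exact h.nonneg j ω

/-- Splitting off the small jumps. -/
lemma limsup_measure_sum_le (h : TailPair P ξ P' ζ α) (hr : Tendsto r atTop atTop)
    (hu : Tendsto u atTop atTop) (hac : AntiCluster P ξ r u) {η ε : ℝ} (hη1 : η < 1) (hε : 0 < ε)
    {f : ℕ → ℝ≥0∞} {l : ℝ≥0∞} (hf : Tendsto f atTop (𝓝 l))
    (hfk : ∀ k, P' {ω | (fun j => ζ j ω) ∈ closedWindow k ((1 - η) / ε)} ≤ f k) :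
    limsup (fun n => P {ω | u n < ∑ j ∈ Finset.Icc (1 : ℤ) (r n), ξ j ω} /
      ((r n : ℝ≥0∞) * P {ω | u n < ξ 0 ω})) atTop ≤
    ENNReal.ofReal (ε ^ (-α)) * l + limsup (fun n : ℕ =>
        P {ω | η * u n < ∑ j ∈ Finset.Icc (1 : ℤ) (r n),
            {ω' | ξ j ω' ≤ ε * u n}.indicator (fun ω' => ξ j ω') ω} /
          ((r n : ℝ≥0∞) * P {ω | u n < ξ 0 ω})) atTop := by
  refine le_trans (limsup_le_limsup (Eventually.of_forall fun n => ?_))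
    ((ennreal_limsup_add_le _ _).trans (add_le_add_left
      (h.limsup_measure_le hr hu hac (sub_pos.2 hη1) hε hf hfk) _))
  simp only
  rw [← ENNReal.add_div]
  refine ENNReal.div_le_div_right ((measure_mono fun ω hω => ?_).trans (measure_union_le _ _)) _
  by_contra hcon
  rw [Set.mem_union, not_or] at hcon
  obtain ⟨h1, h2⟩ := hcon
  simp only [Set.mem_ofPred_eq, not_le, not_lt] at h1 h2 hω
  have h3 : ∑ j ∈ Finset.Icc (1 : ℤ) (r n), ξ j ω =
      (∑ j ∈ Finset.Icc (1 : ℤ) (r n), if u n * ε < ξ j ω then ξ j ω else 0) +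
      ∑ j ∈ Finset.Icc (1 : ℤ) (r n),
            {ω' | ξ j ω' ≤ ε * u n}.indicator (fun ω' => ξ j ω') ω := by
    rw [← Finset.sum_add_distrib]
    refine Finset.sum_congr rfl fun j _ => ?_
    by_cases hj : u n * ε < ξ j ω
    · rw [if_pos hj, Set.indicator_of_notMem, add_zero]
      simp only [Set.mem_ofPred_eq, not_le, mul_comm ε]; exact hj
    · rw [if_neg hj, Set.indicator_of_mem, zero_add]
      simp only [Set.mem_ofPred_eq, mul_comm ε]; exact not_lt.1 hj
  linarith

/-- One `ε` with a finite small-jump term suffices, with the trivial bound `1` for the window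
events. Since `clusterConst` does not enter, this bound can be used to prove it finite. -/
lemma limsup_measure_sum_lt_top (h : TailPair P ξ P' ζ α) (hr : Tendsto r atTop atTop)
    (hu : Tendsto u atTop atTop) (hac : AntiCluster P ξ r u) (hsj : SmallJumps P ξ r u) :
    limsup (fun n => P {ω | u n < ∑ j ∈ Finset.Icc (1 : ℤ) (r n), ξ j ω} /
      ((r n : ℝ≥0∞) * P {ω | u n < ξ 0 ω})) atTop < ⊤ := by
  have h1 := (hsj (1 / 2) (by norm_num)).eventually (gt_mem_nhds ENNReal.zero_lt_top)
  obtain ⟨ε, hε1, hε⟩ := (h1.and self_mem_nhdsWithin).exists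
  refine (h.limsup_measure_sum_le hr hu hac (η := 1 / 2) (by norm_num) hε
    (f := fun _ => 1) tendsto_const_nhds (fun k => prob_le_one)).trans_lt ?_
  exact ENNReal.add_lt_top.2 ⟨ENNReal.mul_lt_top ENNReal.ofReal_lt_top ENNReal.one_lt_top, hε1⟩

lemma clusterConst_lt_top (h : TailPair P ξ P' ζ α) (hr : Tendsto r atTop atTop)
    (hu : Tendsto u atTop atTop) (hac : AntiCluster P ξ r u) (hsj : SmallJumps P ξ r u) :
    clusterConst P' ζ α < ⊤ :=
  ((h.clusterConst_le_liminf hr hu hac).trans liminf_le_limsup).trans_lt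
    (h.limsup_measure_sum_lt_top hr hu hac hsj)

/-- At `c = (1 - η) / ε` the factor `ε ^ (-α)` cancels exactly, so `ε` survives only in the
small-jump term, which vanishes as `ε ↓ 0`. -/
lemma limsup_measure_sum_le_div (h : TailPair P ξ P' ζ α) (hr : Tendsto r atTop atTop)
    (hu : Tendsto u atTop atTop) (hac : AntiCluster P ξ r u) (hsj : SmallJumps P ξ r u)
    {η : ℝ} (hη : 0 < η) (hη1 : η < 1) :
    limsup (fun n => P {ω | u n < ∑ j ∈ Finset.Icc (1 : ℤ) (r n), ξ j ω} /
      ((r n : ℝ≥0∞) * P {ω | u n < ξ 0 ω})) atTop ≤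
      clusterConst P' ζ α / ENNReal.ofReal (1 - η) ^ α := by
  have hη' : 0 < 1 - η := sub_pos.2 hη1
  have h1 := (hsj η hη).const_add (clusterConst P' ζ α / ENNReal.ofReal (1 - η) ^ α)
  rw [add_zero] at h1
  refine ge_of_tendsto h1 (eventually_nhdsWithin_of_forall fun ε hε => ?_)
  have hε : 0 < ε := hε
  obtain ⟨f, l, hf, hl, hfk⟩ := h.exists_bound_closedWindow (h.ae_vanishes hr hu hac)
    (c := (1 - η) / ε) (by positivity)
  refine (h.limsup_measure_sum_le hr hu hac hη1 hε hf hfk).trans ?_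
  gcongr
  refine (mul_le_mul_right hl _).trans (le_of_eq ?_)
  have hεα : ENNReal.ofReal ε ^ α ≠ 0 := by
    rw [ENNReal.ofReal_rpow_of_pos hε]; simpa using Real.rpow_pos_of_pos hε α
  have hεt : ENNReal.ofReal ε ^ α ≠ ⊤ := ENNReal.rpow_ne_top_of_nonneg h.pos.le ENNReal.ofReal_ne_top
  rw [ENNReal.ofReal_div_of_pos hε, ENNReal.div_rpow_of_nonneg _ _ h.pos.le,
    ← ENNReal.ofReal_rpow_of_pos hε, ENNReal.rpow_neg, div_eq_mul_inv, div_eq_mul_inv,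
    div_eq_mul_inv, ENNReal.mul_inv (Or.inr (ENNReal.inv_ne_top.2 hεα))
      (Or.inr (ENNReal.inv_ne_zero.2 hεt)), inv_inv]
  calc _ = (ENNReal.ofReal ε ^ α)⁻¹ * ENNReal.ofReal ε ^ α *
        (clusterConst P' ζ α * (ENNReal.ofReal (1 - η) ^ α)⁻¹) := by ring
    _ = _ := by rw [ENNReal.inv_mul_cancel hεα hεt, one_mul]

/-- The limit theorem for sums of a nonnegative process. -/
theorem tendsto_measure_sum (h : TailPair P ξ P' ζ α) (hr : Tendsto r atTop atTop)
    (hu : Tendsto u atTop atTop) (hac : AntiCluster P ξ r u) (hsj : SmallJumps P ξ r u) :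
    Tendsto (fun n => P {ω | u n < ∑ j ∈ Finset.Icc (1 : ℤ) (r n), ξ j ω} /
      ((r n : ℝ≥0∞) * P {ω | u n < ξ 0 ω})) atTop (𝓝 (clusterConst P' ζ α)) := by
  refine tendsto_of_le_liminf_of_limsup_le (h.clusterConst_le_liminf hr hu hac) ?_
  have h1 : Tendsto (fun η : ℝ => ENNReal.ofReal (1 - η) ^ α) (𝓝[>] 0) (𝓝 1) := by
    have h2 : Continuous fun η : ℝ => ENNReal.ofReal (1 - η) ^ α :=
      ENNReal.continuous_rpow_const.comp (ENNReal.continuous_ofReal.comp (by fun_prop))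
    have h3 := (h2.tendsto 0).mono_left (nhdsWithin_le_nhds (s := Set.Ioi 0))
    simpa using h3
  have h2 : Tendsto (fun η : ℝ => clusterConst P' ζ α / ENNReal.ofReal (1 - η) ^ α) (𝓝[>] 0)
      (𝓝 (clusterConst P' ζ α / 1)) :=
    ENNReal.Tendsto.const_div h1 (Or.inl ENNReal.one_ne_top)
  rw [div_one] at h2
  refine ge_of_tendsto h2 ?_
  filter_upwards [Ioo_mem_nhdsGT (one_pos : (0 : ℝ) < 1)] with η hη
  exact h.limsup_measure_sum_le_div hr hu hac hsj hη.1 hη.2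

end TailPair
end ClusterIndex

/-! ### Transfer to the vector-valued series and to the law of `Q` -/

namespace ClusterIndex

/-- The norm tail of a regularly varying law is regularly varying. -/
lemma RegularlyVaryingLaw.tendsto_tail_ratio {V : Type*} [NormedAddCommGroup V] [NormedSpace ℝ V]
    [MeasurableSpace V] [BorelSpace V] {ν : Measure V} [IsFiniteMeasure ν] {α : ℝ}
    (h : RegularlyVaryingLaw ν α) (hne : ∀ᶠ x : ℝ in atTop, ν {v | x < ‖v‖} ≠ 0) {s : ℝ}
    (hs : 0 < s) :
    Tendsto (fun x : ℝ => ν {v | s * x < ‖v‖} / ν {v | x < ‖v‖}) atTop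
      (𝓝 (ENNReal.ofReal (s ^ (-α)))) := by
  obtain ⟨hα, μ, -, -, hfin, hhom, hconv⟩ := h
  have hnorm : ∀ t : ℝ, 0 < t → ∀ v : V, ‖t⁻¹ • v‖ = ‖v‖ / t := fun t ht v => by
    rw [norm_smul, Real.norm_of_nonneg (inv_nonneg.2 ht.le), inv_mul_eq_div]
  -- By homogeneity, a charged unit sphere would make every sphere of radius in `(1, 2)` charged:
  -- uncountably many disjoint sets inside a region of finite measure.
  have hsphere1 : μ {v | ‖v‖ = 1} = 0 := by
    by_contra hpos
    have hlev : ∀ c ∈ Set.Ioo (1 : ℝ) 2, μ {v | ‖v‖ = c} ≠ 0 := by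
      rintro c ⟨hc1, hc2⟩
      have hc : 0 < c := by linarith
      have h1 := hhom c hc {v | ‖v‖ = 1} (measurableSet_eq_fun measurable_norm measurable_const)
      have h2 : {v : V | c⁻¹ • v ∈ {v : V | ‖v‖ = 1}} = {v | ‖v‖ = c} := by
        ext v; simp only [Set.mem_ofPred_eq]; rw [hnorm c hc, div_eq_one_iff_eq hc.ne']
      rw [h2] at h1
      rw [h1]
      refine mul_ne_zero ?_ hpos
      simpa using Real.rpow_pos_of_pos hc (-α)
    have : IsFiniteMeasure (μ.restrict {v | 1 ≤ ‖v‖}) :=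
      ⟨by rw [Measure.restrict_apply_univ]; exact hfin 1 one_pos⟩
    have hcount := Measure.countable_meas_level_set_pos (μ := μ.restrict {v | 1 ≤ ‖v‖})
      (measurable_norm (α := V))
    refine not_countable_Ioo one_lt_two (hcount.mono fun c hc => ?_)
    simp only [Set.mem_ofPred_eq]
    rw [Measure.restrict_apply (measurableSet_eq_fun measurable_norm measurable_const)]
    refine pos_iff_ne_zero.2 ?_
    convert hlev c hc using 2
    refine Set.inter_eq_left.2 fun v (hv : ‖v‖ = c) => ?_
    change 1 ≤ ‖v‖
    linarith [hc.1]
  have hsphere : ∀ c : ℝ, 0 < c → μ {v | ‖v‖ = c} = 0 := by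
    intro c hc
    have h1 := hhom c hc {v | ‖v‖ = 1} (measurableSet_eq_fun measurable_norm measurable_const)
    have h2 : {v : V | c⁻¹ • v ∈ {v : V | ‖v‖ = 1}} = {v | ‖v‖ = c} := by
      ext v; simp only [Set.mem_ofPred_eq]; rw [hnorm c hc, div_eq_one_iff_eq hc.ne']
    rw [← h2, h1, hsphere1, mul_zero]
  have hball : ∀ c : ℝ, 0 < c →
      Tendsto (fun x : ℝ => ν {v | c * x < ‖v‖} / ν {v | x < ‖v‖}) atTop (𝓝 (μ {v | c < ‖v‖})) := by
    intro c hc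
    have h1 := hconv {v | c < ‖v‖} (measurableSet_lt measurable_const measurable_norm)
      (fun h0 => by
        have : (0 : V) ∈ {v : V | c ≤ ‖v‖} :=
          closure_minimal (fun v (hv : c < ‖v‖) => hv.le) (isClosed_le continuous_const continuous_norm)
            h0
        simp only [Set.mem_ofPred_eq, norm_zero] at this
        linarith)
      (measure_mono_null ((frontier_lt_subset_eq continuous_const continuous_norm).trans
        fun v hv => Eq.symm hv) (hsphere c hc))
    refine h1.congr' ?_
    filter_upwards [eventually_gt_atTop 0] with x hx
    congr 2
    ext v
    simp only [Set.mem_ofPred_eq]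
    rw [hnorm x hx, lt_div_iff₀ hx]
  -- Normalising by the norm tail itself fixes the scale of `μ`: the ratio at `c = 1` is constantly
  -- `1`.
  have hone : μ {v | 1 < ‖v‖} = 1 := by
    refine tendsto_nhds_unique (hball 1 one_pos) (tendsto_const_nhds.congr' ?_)
    filter_upwards [hne] with x hx
    rw [one_mul, ENNReal.div_self hx (measure_ne_top _ _)]
  have h1 := hhom s hs {v | 1 < ‖v‖} (measurableSet_lt measurable_const measurable_norm)
  have h2 : {v : V | s⁻¹ • v ∈ {v : V | 1 < ‖v‖}} = {v | s < ‖v‖} := by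
    ext v; simp only [Set.mem_ofPred_eq]; rw [hnorm s hs, lt_div_iff₀ hs, one_mul]
  rw [h2, hone, mul_one] at h1
  rw [← h1]
  exact hball s hs

variable {E : Type*} [NormedAddCommGroup E] [NormedSpace ℝ E] [FiniteDimensional ℝ E]
    [MeasurableSpace E] [BorelSpace E]
    {Ω : Type*} [MeasurableSpace Ω] {P : Measure Ω} [IsProbabilityMeasure P]
    {Ω' : Type*} [MeasurableSpace Ω'] {P' : Measure Ω'} [IsProbabilityMeasure P']
    {X : ℤ → Ω → E} {Y : ℤ → Ω' → E} {α : ℝ}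

/-- The norms of a stationary regularly varying series and of its tail process. -/
lemma tailPair_norm (hX : ∀ j, Measurable (X j)) (hstat : Stationary P X)
    (hRV : RegularlyVaryingSeries P X α) (hY : IsTailProcess P X P' Y) :
    TailPair P (fun j ω => ‖X j ω‖) P' (fun j ω => ‖Y j ω‖) α where
  meas j := (hX j).norm
  meas' j := (hY.1 j).norm
  nonneg _ _ := norm_nonneg _
  nonneg' _ _ := norm_nonneg _
  pos := (hRV 0 0 le_rfl).1
  stat k := by
    have hm : Measurable fun (y : ℤ → E) (j : ℤ) => ‖y j‖ :=
      measurable_pi_lambda _ fun j => (measurable_pi_apply j).norm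
    have h1 := congrArg (fun m => m.map fun (y : ℤ → E) (j : ℤ) => ‖y j‖) (hstat k)
    rw [Measure.map_map hm (measurable_pi_lambda _ fun j => hX _),
      Measure.map_map hm (measurable_pi_lambda _ fun j => hX _)] at h1
    exact h1
  ratio s hs := by
    have : ProperSpace E := FiniteDimensional.proper_real E
    have hms : Measurable (stretch X 0 0) := measurable_pi_lambda _ fun j => hX _
    have hnorm : ∀ ω, ‖stretch X 0 0 ω‖ = ‖X 0 ω‖ := by
      intro ω
      refine le_antisymm ((pi_norm_le_iff_of_nonneg (norm_nonneg _)).2 ?_)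
        (norm_le_pi_norm (stretch X 0 0 ω) ⟨0, by simp⟩)
      rintro ⟨j, hj⟩
      rw [Finset.mem_Icc] at hj
      obtain rfl : j = 0 := le_antisymm hj.2 hj.1
      exact le_rfl
    have hmap : ∀ c : ℝ, (P.map (stretch X 0 0)) {v | c < ‖v‖} = P {ω | c < ‖X 0 ω‖} := by
      intro c
      rw [Measure.map_apply hms (measurableSet_lt measurable_const measurable_norm)]
      congr 1; ext ω
      change c < ‖stretch X 0 0 ω‖ ↔ _
      rw [hnorm]; rfl
    have hne : ∀ᶠ x : ℝ in atTop, (P.map (stretch X 0 0)) {v | x < ‖v‖} ≠ 0 := by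
      have h1 := hY.2 0 0 le_rfl (BoundedContinuousFunction.const _ 1)
      simp only [BoundedContinuousFunction.const_apply, integral_const, smul_eq_mul, mul_one,
        probReal_univ] at h1
      filter_upwards [h1.eventually (lt_mem_nhds (show (0 : ℝ) < 1 by norm_num))] with x hx h0
      rw [hmap] at h0
      rw [ProbabilityTheory.cond_eq_zero_of_meas_eq_zero h0] at hx
      simp at hx
    have := (hRV 0 0 le_rfl).tendsto_tail_ratio hne hs
    simpa only [hmap] using this
  conv J a f := by
    have : ProperSpace E := FiniteDimensional.proper_real E
    -- The sum of the absolute offsets dominates each of them, so the window from `-N` to `N`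
    -- contains every `j - a`.
    set N : ℕ := ∑ j ∈ J, (j - a).natAbs with hN
    have hmem : ∀ j : J, (j : ℤ) - a ∈ Finset.Icc (-N : ℤ) N := by
      rintro ⟨j, hj⟩
      have h4 : (j - a).natAbs ≤ N :=
        Finset.single_le_sum (f := fun j : ℤ => (j - a).natAbs) (fun _ _ => Nat.zero_le _) hj
      rw [Finset.mem_Icc]
      simp only
      omega
    have hg : Continuous fun (v : Finset.Icc (-N : ℤ) N → E) (j : J) => ‖v ⟨j - a, hmem j⟩‖ := by
      fun_prop
    have h1 := hY.2 (-N) N (by omega) (f.compContinuous ⟨_, hg⟩)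
    refine h1.congr' ?_
    filter_upwards [eventually_gt_atTop 0] with x hx
    refine integral_congr_ae (ae_of_all _ fun ω => ?_)
    simp only [BoundedContinuousFunction.compContinuous_apply, ContinuousMap.coe_mk]
    congr 1
    ext j
    rw [Pi.smul_apply, norm_smul, Real.norm_of_nonneg (inv_nonneg.2 hx.le)]
    rfl

lemma supNorm_eq_of_isFirstMax {y : ℤ → E} {m : ℤ} (h : IsFirstMax (fun j => ‖y j‖) m) :
    supNorm y = ‖y m‖ₑ :=
  le_antisymm (iSup_le fun j => enorm_le_iff_norm_le.2 (h.2 j)) (le_iSup (fun j => ‖y j‖ₑ) m)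

/-- Vanishing is essential for minimality: otherwise the values before `m` could approach the
maximum without attaining it, and an earlier supremum would equal it. -/
lemma infargmax_eq_of_isFirstMax {y : ℤ → E} (hv : Vanishes fun j => ‖y j‖) {m : ℤ}
    (h : IsFirstMax (fun j => ‖y j‖) m) (hm : 0 < ‖y m‖) : infargmax y = ((m : ℝ) : EReal) := by
  have hsup := supNorm_eq_of_isFirstMax h
  refine le_antisymm (iInf₂_le m ?_) (le_iInf₂ fun j hj => ?_)
  · rw [hsup]
    exact le_antisymm (iSup₂_le fun j _ => enorm_le_iff_norm_le.2 (h.2 j))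
      (le_iSup₂ (f := fun (i : ℤ) (_ : i ≤ m) => ‖y i‖ₑ) m le_rfl)
  · rw [EReal.coe_le_coe_iff, Int.cast_le]
    by_contra hlt
    rw [not_le] at hlt
    refine absurd hj (ne_of_lt ?_)
    rw [hsup]
    have hfin : {i | ‖y m‖ / 2 < ‖y i‖ ∧ i ≤ j}.Finite :=
      (hv (‖y m‖ / 2) (by positivity)).subset fun i hi => hi.1
    have hm' : 0 < ‖y m‖ₑ := by rw [← ofReal_norm]; simpa using hm
    have hhalf : ENNReal.ofReal (‖y m‖ / 2) < ‖y m‖ₑ := by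
      rw [← ofReal_norm, ENNReal.ofReal_lt_ofReal_iff hm]; linarith
    -- Before `m`, only finitely many values exceed half the maximum, and each is strictly below it;
    -- the others are bounded by the half.
    have hK : max (ENNReal.ofReal (‖y m‖ / 2)) (hfin.toFinset.sup fun i => ‖y i‖ₑ) < ‖y m‖ₑ := by
      refine max_lt hhalf ((Finset.sup_lt_iff hm').2 fun i hi => ?_)
      rw [Set.Finite.mem_toFinset] at hi
      rw [← ofReal_norm, ← ofReal_norm, ENNReal.ofReal_lt_ofReal_iff hm]
      exact h.1 i (lt_of_le_of_lt hi.2 hlt)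
    refine lt_of_le_of_lt (iSup₂_le fun i hi => ?_) hK
    by_cases hi2 : ‖y m‖ / 2 < ‖y i‖
    · exact le_max_of_le_right (Finset.le_sup (f := fun i => ‖y i‖ₑ)
        (hfin.mem_toFinset.2 ⟨hi2, hi⟩))
    · refine le_max_of_le_left ?_
      rw [← ofReal_norm]
      exact ENNReal.ofReal_le_ofReal (not_lt.1 hi2)

lemma ae_exists_infargmax (h : TailPair P (fun j ω => ‖X j ω‖) P' (fun j ω => ‖Y j ω‖) α)
    (hv : ∀ᵐ ω ∂P', Vanishes fun j => ‖Y j ω‖) :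
    ∀ᵐ ω ∂P', ∃ m : ℤ, infargmax (fun j => Y j ω) = ((m : ℝ) : EReal) ∧
      IsFirstMax (fun j => ‖Y j ω‖) m := by
  filter_upwards [hv, h.one_lt_ae] with ω h1 h2
  obtain ⟨m, hm⟩ := h1.exists_isFirstMax (i := 0) (by linarith)
  exact ⟨m, infargmax_eq_of_isFirstMax h1 hm (by have := hm.2 0; simp only at this; linarith), hm⟩

lemma anchoredAtZero_ae_eq (h : TailPair P (fun j ω => ‖X j ω‖) P' (fun j ω => ‖Y j ω‖) α)
    (hv : ∀ᵐ ω ∂P', Vanishes fun j => ‖Y j ω‖) :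
    anchoredAtZero Y =ᵐ[P'] {ω | IsFirstMax (fun j => ‖Y j ω‖) 0} := by
  filter_upwards [ae_exists_infargmax h hv] with ω ⟨m, h1, h2⟩
  refine propext ⟨fun (h0 : infargmax (fun j => Y j ω) = 0) => ?_,
    fun (h0 : IsFirstMax (fun j => ‖Y j ω‖) 0) => ?_⟩
  · rw [h1] at h0
    have : m = 0 := by exact_mod_cast h0
    subst this
    exact h2
  · have : m = 0 := h2.unique h0
    change infargmax (fun j => Y j ω) = 0
    rw [h1, this]; simp

/-- Multiplying by the index cancels the normalisation of the conditional law, and on the anchored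
event the supremum is `‖Y 0‖`, so the norms of `Q` are the ratios in `angularSum`. -/
lemma candidateIndex_mul_lintegral (hYm : ∀ j, Measurable (Y j))
    (h : TailPair P (fun j ω => ‖X j ω‖) P' (fun j ω => ‖Y j ω‖) α)
    (hv : ∀ᵐ ω ∂P', Vanishes fun j => ‖Y j ω‖) (hpos : candidateIndex P' Y ≠ 0) :
    candidateIndex P' Y * ∫⁻ q, (∑' j : ℤ, ‖q j‖ₑ) ^ α ∂(lawQ P' Y) =
      clusterConst P' (fun j ω => ‖Y j ω‖) α := by
  have : ProperSpace E := FiniteDimensional.proper_real E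
  have hFM : MeasurableSet {ω | IsFirstMax (fun j => ‖Y j ω‖) 0} :=
    h.measurable_path' (measurableSet_isFirstMax 0)
  have hsup : Measurable fun ω => (supNorm fun i => Y i ω).toReal :=
    (Measurable.iSup fun j => (hYm j).enorm).ennreal_toReal
  have hφ : Measurable fun ω (j : ℤ) => (supNorm fun i => Y i ω).toReal⁻¹ • Y j ω :=
    measurable_pi_lambda _ fun j => hsup.inv.smul (hYm j)
  have hg : Measurable fun q : ℤ → E => (∑' j : ℤ, ‖q j‖ₑ) ^ α :=
    (Measurable.tsum fun j => (measurable_pi_apply j).enorm).pow_const α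
  rw [lawQ, lintegral_map hg hφ, ProbabilityTheory.cond, lintegral_smul_measure, smul_eq_mul,
    ← mul_assoc, candidateIndex, ENNReal.mul_inv_cancel (a := P' (anchoredAtZero Y)) hpos (measure_ne_top _ _), one_mul,
    Measure.restrict_congr_set (anchoredAtZero_ae_eq h hv), ← lintegral_indicator hFM, clusterConst]
  refine lintegral_congr fun ω => ?_
  by_cases hω : IsFirstMax (fun j => ‖Y j ω‖) 0
  · rw [Set.indicator_of_mem (by exact hω), angularSum_of_isFirstMax hω]
    congr 1
    refine tsum_congr fun j => ?_
    rw [supNorm_eq_of_isFirstMax hω, toReal_enorm, ← ofReal_norm, norm_smul,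
      Real.norm_of_nonneg (inv_nonneg.2 (norm_nonneg _)), inv_mul_eq_div]
  · rw [Set.indicator_of_notMem (by exact hω), angularSum_of_not_isFirstMax hω,
      ENNReal.zero_rpow_of_pos h.pos]

end ClusterIndex

theorem mainTheorem7
    {E : Type*} [NormedAddCommGroup E] [NormedSpace ℝ E] [FiniteDimensional ℝ E]
    [MeasurableSpace E] [BorelSpace E]
    {Ω : Type*} [MeasurableSpace Ω] (P : Measure Ω) [IsProbabilityMeasure P]
    {Ω' : Type*} [MeasurableSpace Ω'] (P' : Measure Ω') [IsProbabilityMeasure P']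
    (X : ℤ → Ω → E) (hX : ∀ j, Measurable (X j))
    (hstat : ClusterIndex.Stationary P X)
    (α : ℝ) (hRV : ClusterIndex.RegularlyVaryingSeries P X α)
    (Y : ℤ → Ω' → E) (hY : ClusterIndex.IsTailProcess P X P' Y)
    (r : ℕ → ℕ) (u : ℕ → ℝ)
    (hr : Tendsto r atTop atTop) (hu : Tendsto u atTop atTop)
    (hDH : ClusterIndex.CondDH P X r u)
    (hANSJB : ClusterIndex.CondANSJB P X r u) :
    (∀ᵐ ω ∂P', ∃ m : ℤ, ClusterIndex.infargmax (fun j => Y j ω) = ((m : ℝ) : EReal)) ∧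
    0 < ClusterIndex.candidateIndex P' Y ∧
    Tendsto
      (fun n : ℕ =>
        P {ω | u n < ∑ j ∈ Finset.Icc (1 : ℤ) (r n), ‖X j ω‖} /
          ((r n : ℝ≥0∞) * P {ω | u n < ‖X 0 ω‖}))
      atTop
      (𝓝 (ClusterIndex.candidateIndex P' Y *
        ∫⁻ q, (∑' j : ℤ, ‖q j‖ₑ) ^ α ∂(ClusterIndex.lawQ P' Y))) ∧
    ∫⁻ q, (∑' j : ℤ, ‖q j‖ₑ) ^ α ∂(ClusterIndex.lawQ P' Y) < ∞ := by
  have h := ClusterIndex.tailPair_norm hX hstat hRV hY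
  have hv := h.ae_vanishes hr hu hDH
  have hpos : 0 < ClusterIndex.candidateIndex P' Y := by
    rw [ClusterIndex.candidateIndex, measure_congr (ClusterIndex.anchoredAtZero_ae_eq h hv)]
    exact h.measure_isFirstMax_pos hv
  have hmul := ClusterIndex.candidateIndex_mul_lintegral hY.1 h hv hpos.ne'
  refine ⟨(ClusterIndex.ae_exists_infargmax h hv).mono fun ω hω => hω.imp fun m hm => hm.1, hpos,
    ?_, ?_⟩
  · rw [hmul]
    exact h.tendsto_measure_sum hr hu hDH hANSJB
  · have hfin := h.clusterConst_lt_top hr hu hDH hANSJB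
    rw [← hmul] at hfin
    exact ENNReal.lt_top_of_mul_ne_top_right hfin.ne hpos.ne'
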